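/- Let $p$ be a prime and let $G = C_p$ be a group of order $p$. Let $B(G,G)$ be the double Burnside ring of $G$: the Grothendieck group, with respect to disjoint union, of isomorphism classes of finite $(G,G)$-bisets (finite sets with commuting left and right actions of $G$), with multiplication induced by $[X][Y]=[X\times_G Y]$, where $X\times_G Y$ is the set of $G$-orbits on $X\times Y$ for the action $h\cdot(x,y)=(xh^{-1},hy)$, and with identity $\mathrm{Id}_G=[G]$. Let $u\mapsto u^\circ$ be the anti-involution of $B(G,G)$ with $[X]^\circ=[X^\circ]$, where the opposite biset $X^\circ$ is the set $X$ with the actions $h\cdot x\cdot g=g^{-1}xh^{-1}$. Let $B_\circ(G,G)$ be the group of orthogonal units of $B(G,G)$, that is, of the units $u\in B(G,G)^\times$ with $uu^\circ=u^\circ u=\mathrm{Id}_G$. Then, writing $C_n$ for the cyclic group of order $n$ and $D_8$ for the dihedral group of order $8$: (i) if $p=2$, then $B_\circ(G,G)\cong C_2\times D_8$; (ii) if $p=3$, then $B_\circ(G,G)\cong C_{p-1}\times C_2^3$; (iii) if $p>3$, then $B_\circ(G,G)\cong C_{p-1}\times C_2^2$. -/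

import Mathlib

universe u

/-- A finite `(G, H)`-biset: a finite set with a left action of `G` and a right action of `H`
(that is, an action of the opposite group `Hᵐᵒᵖ`, so that `x · h` is `MulOpposite.op h • x`)
which commute: `(g · x) · h = g · (x · h)`. -/
structure FinBiset (G H : Type u) [Group G] [Group H] where
  /-- the underlying set -/
  carrier : Type u
  [finite : Finite carrier]
  [left : MulAction G carrier]
  [right : MulAction Hᵐᵒᵖ carrier]
  [comm : SMulCommClass G Hᵐᵒᵖ carrier]

namespace FinBiset

open MulOpposite

attribute [instance] FinBiset.finite FinBiset.left FinBiset.right FinBiset.comm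

section Basic

variable {G H K L : Type u} [Group G] [Group H] [Group K] [Group L]

/-- An isomorphism of bisets: a bijection compatible with both actions. -/
structure Iso (X Y : FinBiset G H) where
  /-- the underlying bijection -/
  toEquiv : X.carrier ≃ Y.carrier
  map_left : ∀ (g : G) (x : X.carrier), toEquiv (g • x) = g • toEquiv x
  map_right : ∀ (h : Hᵐᵒᵖ) (x : X.carrier), toEquiv (h • x) = h • toEquiv x

/-- The identity isomorphism. -/
def Iso.refl (X : FinBiset G H) : Iso X X := ⟨Equiv.refl _, fun _ _ => rfl, fun _ _ => rfl⟩

/-- The inverse of an isomorphism. -/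
def Iso.symm {X Y : FinBiset G H} (e : Iso X Y) : Iso Y X :=
  ⟨e.toEquiv.symm,
    fun g y => by rw [Equiv.symm_apply_eq, e.map_left, Equiv.apply_symm_apply],
    fun h y => by rw [Equiv.symm_apply_eq, e.map_right, Equiv.apply_symm_apply]⟩

/-- The composite of two isomorphisms. -/
def Iso.trans {X Y Z : FinBiset G H} (e : Iso X Y) (f : Iso Y Z) : Iso X Z :=
  ⟨e.toEquiv.trans f.toEquiv,
    fun g x => by simp [e.map_left, f.map_left],
    fun h x => by simp [e.map_right, f.map_right]⟩

/-- Isomorphism of bisets as an equivalence relation. -/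
instance isoSetoid (G H : Type u) [Group G] [Group H] : Setoid (FinBiset G H) where
  r X Y := Nonempty (Iso X Y)
  iseqv := ⟨fun X => ⟨Iso.refl X⟩, fun ⟨e⟩ => ⟨e.symm⟩, fun ⟨e⟩ ⟨f⟩ => ⟨e.trans f⟩⟩

/-- The empty biset. -/
def empty (G H : Type u) [Group G] [Group H] : FinBiset G H :=
  letI : MulAction G PEmpty.{u + 1} :=
    { smul := fun _ x => x, one_smul := fun _ => rfl, mul_smul := fun _ _ _ => rfl }
  letI : MulAction Hᵐᵒᵖ PEmpty.{u + 1} :=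
    { smul := fun _ x => x, one_smul := fun _ => rfl, mul_smul := fun _ _ _ => rfl }
  haveI : SMulCommClass G Hᵐᵒᵖ PEmpty.{u + 1} := ⟨fun _ _ _ => rfl⟩
  ⟨PEmpty.{u + 1}⟩

/-- The disjoint union of two bisets. -/
def sum (X Y : FinBiset G H) : FinBiset G H := ⟨X.carrier ⊕ Y.carrier⟩

/-- The group `G` as a `(G, G)`-biset, acting on itself by left and right multiplication. -/
def regular (G : Type u) [Group G] [Finite G] : FinBiset G G := ⟨G⟩

/-- The opposite biset `X°`: the same set, with `h · x · g = g⁻¹ x h⁻¹`. -/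
def opposite (X : FinBiset G H) : FinBiset H G :=
  letI left : MulAction H X.carrier :=
    { smul := fun h x => op h⁻¹ • x
      one_smul := fun x => by
        change op (1 : H)⁻¹ • x = x
        simp
      mul_smul := fun a b x => by
        change op (a * b)⁻¹ • x = op a⁻¹ • op b⁻¹ • x
        rw [smul_smul, ← op_mul, mul_inv_rev] }
  letI right : MulAction Gᵐᵒᵖ X.carrier :=
    { smul := fun g x => (unop g)⁻¹ • x
      one_smul := fun x => by
        change (unop (1 : Gᵐᵒᵖ))⁻¹ • x = x
        simp
      mul_smul := fun a b x => by
        change (unop (a * b))⁻¹ • x = (unop a)⁻¹ • (unop b)⁻¹ • x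
        rw [smul_smul, unop_mul, mul_inv_rev] }
  { carrier := X.carrier
    left := left
    right := right
    comm := @SMulCommClass.mk H Gᵐᵒᵖ X.carrier left.toSMul right.toSMul
      fun h g x => (smul_comm (unop g)⁻¹ (op h⁻¹) x).symm }

/-- The orbit relation of `H` on `X × Y` for the action `h · (x, y) = (x h⁻¹, h y)`. -/
def tensorSetoid (X : FinBiset G H) (Y : FinBiset H K) : Setoid (X.carrier × Y.carrier) where
  r a b := ∃ h : H, b = (op h⁻¹ • a.1, h • a.2)
  iseqv :=
    { refl := fun a => ⟨1, by simp⟩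
      symm := by
        rintro a _ ⟨h, rfl⟩
        exact ⟨h⁻¹, by simp⟩
      trans := by
        rintro a _ _ ⟨h, rfl⟩ ⟨k, rfl⟩
        exact ⟨k * h, by simp [smul_smul]⟩ }

/-- The tensor product `X ×_H Y` of bisets: the set of `H`-orbits on `X × Y` for the action
`h · (x, y) = (x h⁻¹, h y)`, with `g · (x, y) · k = (g x, y k)`. -/
def tensor (X : FinBiset G H) (Y : FinBiset H K) : FinBiset G K :=
  letI left : MulAction G (Quotient (tensorSetoid X Y)) :=
    { smul := fun g => Quotient.map (fun a => (g • a.1, a.2)) (by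
        rintro a _ ⟨h, rfl⟩
        exact ⟨h, Prod.ext (smul_comm g (op h⁻¹) a.1) rfl⟩)
      one_smul := by
        rintro ⟨a⟩
        exact congrArg (Quotient.mk (tensorSetoid X Y)) (Prod.ext (one_smul _ _) rfl)
      mul_smul := by
        rintro g g' ⟨a⟩
        exact congrArg (Quotient.mk (tensorSetoid X Y)) (Prod.ext (mul_smul _ _ _) rfl) }
  letI right : MulAction Kᵐᵒᵖ (Quotient (tensorSetoid X Y)) :=
    { smul := fun k => Quotient.map (fun a => (a.1, k • a.2)) (by
        rintro a _ ⟨h, rfl⟩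
        exact ⟨h, Prod.ext rfl (smul_comm h k a.2).symm⟩)
      one_smul := by
        rintro ⟨a⟩
        exact congrArg (Quotient.mk (tensorSetoid X Y)) (Prod.ext rfl (one_smul _ _))
      mul_smul := by
        rintro k k' ⟨a⟩
        exact congrArg (Quotient.mk (tensorSetoid X Y)) (Prod.ext rfl (mul_smul _ _ _)) }
  { carrier := Quotient (tensorSetoid X Y)
    left := left
    right := right
    comm := @SMulCommClass.mk G Kᵐᵒᵖ _ left.toSMul right.toSMul (by
      rintro g k ⟨a⟩
      rfl) }

/-- The class `(x ,_H y)` in the tensor product. -/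
def tmk {X : FinBiset G H} {Y : FinBiset H K} (x : X.carrier) (y : Y.carrier) :
    (tensor X Y).carrier :=
  Quotient.mk (tensorSetoid X Y) (x, y)

theorem tmk_ind {X : FinBiset G H} {Y : FinBiset H K} {P : (tensor X Y).carrier → Prop}
    (h : ∀ x y, P (tmk x y)) (t : (tensor X Y).carrier) : P t :=
  Quotient.ind (fun a => h a.1 a.2) t

theorem tmk_balanced {X : FinBiset G H} {Y : FinBiset H K} (x : X.carrier) (h : H)
    (y : Y.carrier) : (tmk (op h • x) y : (tensor X Y).carrier) = tmk x (h • y) :=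
  Quotient.sound' ⟨h, by simp⟩

theorem left_tmk {X : FinBiset G H} {Y : FinBiset H K} (g : G) (x : X.carrier)
    (y : Y.carrier) : g • (tmk x y : (tensor X Y).carrier) = tmk (g • x) y := rfl

theorem right_tmk {X : FinBiset G H} {Y : FinBiset H K} (k : Kᵐᵒᵖ) (x : X.carrier)
    (y : Y.carrier) : k • (tmk x y : (tensor X Y).carrier) = tmk x (k • y) := rfl

/-- The universal property of the tensor product. -/
def tlift {X : FinBiset G H} {Y : FinBiset H K} {T : Type*} (f : X.carrier → Y.carrier → T)
    (hf : ∀ x (h : H) y, f (op h • x) y = f x (h • y)) : (tensor X Y).carrier → T :=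
  Quotient.lift (s := tensorSetoid X Y) (fun a => f a.1 a.2) (by
    rintro a _ ⟨h, rfl⟩
    simp [← hf])

theorem tlift_tmk {X : FinBiset G H} {Y : FinBiset H K} {T : Type*}
    (f : X.carrier → Y.carrier → T) (hf : ∀ x (h : H) y, f (op h • x) y = f x (h • y))
    (x : X.carrier) (y : Y.carrier) : tlift f hf (tmk x y) = f x y := rfl

/-! Functoriality of the operations with respect to isomorphisms. -/

/-- Disjoint unions of isomorphic bisets are isomorphic. -/
def sumCongr {X X' Y Y' : FinBiset G H} (e : Iso X X') (f : Iso Y Y') :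
    Iso (sum X Y) (sum X' Y') where
  toEquiv := Equiv.sumCongr e.toEquiv f.toEquiv
  map_left := by
    rintro g (x | y)
    · exact congrArg Sum.inl (e.map_left g x)
    · exact congrArg Sum.inr (f.map_left g y)
  map_right := by
    rintro g (x | y)
    · exact congrArg Sum.inl (e.map_right g x)
    · exact congrArg Sum.inr (f.map_right g y)

/-- Opposites of isomorphic bisets are isomorphic. -/
def oppositeCongr {X Y : FinBiset G H} (e : Iso X Y) : Iso (opposite X) (opposite Y) :=
  ⟨e.toEquiv, fun h x => e.map_right (op h⁻¹) x, fun g x => e.map_left (unop g)⁻¹ x⟩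

/-- Tensor products of isomorphic bisets are isomorphic. -/
def tensorCongr {X X' : FinBiset G H} {Y Y' : FinBiset H K} (e : Iso X X') (f : Iso Y Y') :
    Iso (tensor X Y) (tensor X' Y') where
  toEquiv :=
    { toFun := tlift (fun x y => tmk (e.toEquiv x) (f.toEquiv y))
        (fun x h y => by rw [e.map_right, f.map_left, tmk_balanced])
      invFun := tlift (fun x y => tmk (e.symm.toEquiv x) (f.symm.toEquiv y))
        (fun x h y => by rw [e.symm.map_right, f.symm.map_left, tmk_balanced])
      left_inv := tmk_ind fun x y => by simp [tlift_tmk, Iso.symm]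
      right_inv := tmk_ind fun x y => by simp [tlift_tmk, Iso.symm] }
  map_left g := tmk_ind fun x y => by simp [left_tmk, tlift_tmk, e.map_left]
  map_right k := tmk_ind fun x y => by simp [right_tmk, tlift_tmk, f.map_right]

/-! The canonical isomorphisms behind the ring laws. -/

/-- Commutativity of the disjoint union. -/
def sumComm (X Y : FinBiset G H) : Iso (sum X Y) (sum Y X) where
  toEquiv := Equiv.sumComm _ _
  map_left := by rintro g (x | y) <;> rfl
  map_right := by rintro g (x | y) <;> rfl

/-- Associativity of the disjoint union. -/
def sumAssoc (X Y Z : FinBiset G H) : Iso (sum (sum X Y) Z) (sum X (sum Y Z)) where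
  toEquiv := Equiv.sumAssoc _ _ _
  map_left := by rintro g ((x | y) | z) <;> rfl
  map_right := by rintro g ((x | y) | z) <;> rfl

/-- The empty biset is neutral for the disjoint union. -/
def emptySum (X : FinBiset G H) : Iso (sum (empty G H) X) X where
  toEquiv := Equiv.emptySum PEmpty X.carrier
  map_left := by
    rintro g (x | y)
    · exact x.elim
    · rfl
  map_right := by
    rintro g (x | y)
    · exact x.elim
    · rfl

/-- The empty biset is absorbing on the left. -/
def emptyTensor (Y : FinBiset H K) : Iso (tensor (empty G H) Y) (empty G K) where
  toEquiv :=
    { toFun := tlift (fun x _ => PEmpty.elim x) (fun x _ _ => PEmpty.elim x)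
      invFun := fun x => PEmpty.elim x
      left_inv := tmk_ind fun x _ => PEmpty.elim x
      right_inv := fun x => PEmpty.elim x }
  map_left _ := tmk_ind fun x _ => PEmpty.elim x
  map_right _ := tmk_ind fun x _ => PEmpty.elim x

/-- The empty biset is absorbing on the right. -/
def tensorEmpty (X : FinBiset G H) : Iso (tensor X (empty H K)) (empty G K) where
  toEquiv :=
    { toFun := tlift (fun _ y => PEmpty.elim y) (fun _ _ y => PEmpty.elim y)
      invFun := fun x => PEmpty.elim x
      left_inv := tmk_ind fun _ y => PEmpty.elim y
      right_inv := fun x => PEmpty.elim x }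
  map_left _ := tmk_ind fun _ y => PEmpty.elim y
  map_right _ := tmk_ind fun _ y => PEmpty.elim y

/-- The tensor product distributes over disjoint unions on the left. -/
def sumTensor (X X' : FinBiset G H) (Y : FinBiset H K) :
    Iso (tensor (sum X X') Y) (sum (tensor X Y) (tensor X' Y)) where
  toEquiv :=
    { toFun := tlift (fun s y => Sum.elim (fun x => Sum.inl (tmk x y))
          (fun x => Sum.inr (tmk x y)) s) (by
        rintro (x | x) h y
        · exact congrArg Sum.inl (tmk_balanced x h y)
        · exact congrArg Sum.inr (tmk_balanced x h y))
      invFun := fun s => Sum.elim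
        (tlift (fun x y => tmk (X := sum X X') (Sum.inl x) y)
          (fun x h y => tmk_balanced (X := sum X X') (Sum.inl x) h y))
        (tlift (fun x y => tmk (X := sum X X') (Sum.inr x) y)
          (fun x h y => tmk_balanced (X := sum X X') (Sum.inr x) h y)) s
      left_inv := tmk_ind fun s y => by rcases s with x | x <;> rfl
      right_inv := by
        rintro (t | t)
        · revert t
          exact tmk_ind fun _ _ => rfl
        · revert t
          exact tmk_ind fun _ _ => rfl }
  map_left g := tmk_ind fun s y => by rcases s with x | x <;> rfl
  map_right g := tmk_ind fun s y => by rcases s with x | x <;> rfl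

/-- The tensor product distributes over disjoint unions on the right. -/
def tensorSum (X : FinBiset G H) (Y Y' : FinBiset H K) :
    Iso (tensor X (sum Y Y')) (sum (tensor X Y) (tensor X Y')) where
  toEquiv :=
    { toFun := tlift (fun x s => Sum.elim (fun y => Sum.inl (tmk x y))
          (fun y => Sum.inr (tmk x y)) s) (by
        rintro x h (y | y)
        · exact congrArg Sum.inl (tmk_balanced x h y)
        · exact congrArg Sum.inr (tmk_balanced x h y))
      invFun := fun s => Sum.elim
        (tlift (fun x y => tmk (Y := sum Y Y') x (Sum.inl y))
          (fun x h y => tmk_balanced (Y := sum Y Y') x h (Sum.inl y)))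
        (tlift (fun x y => tmk (Y := sum Y Y') x (Sum.inr y))
          (fun x h y => tmk_balanced (Y := sum Y Y') x h (Sum.inr y))) s
      left_inv := tmk_ind fun x s => by rcases s with y | y <;> rfl
      right_inv := by
        rintro (t | t)
        · revert t
          exact tmk_ind fun _ _ => rfl
        · revert t
          exact tmk_ind fun _ _ => rfl }
  map_left g := tmk_ind fun x s => by rcases s with y | y <;> rfl
  map_right g := tmk_ind fun x s => by rcases s with y | y <;> rfl

/-- The map `(x ,_H y) ↦ (x ,_H (y ,_K z))` for a fixed `z`. -/
def assocAux (X : FinBiset G H) (Y : FinBiset H K) (Z : FinBiset K L) (z : Z.carrier) :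
    (tensor X Y).carrier → (tensor X (tensor Y Z)).carrier :=
  tlift (fun x y => tmk (Y := tensor Y Z) x (tmk y z))
    (fun x h y => tmk_balanced (Y := tensor Y Z) x h (tmk y z))

/-- The map `(y ,_K z) ↦ ((x ,_H y) ,_K z)` for a fixed `x`. -/
def assocAux' (X : FinBiset G H) (Y : FinBiset H K) (Z : FinBiset K L) (x : X.carrier) :
    (tensor Y Z).carrier → (tensor (tensor X Y) Z).carrier :=
  tlift (fun y z => tmk (X := tensor X Y) (tmk x y) z)
    (fun y k z => tmk_balanced (X := tensor X Y) (tmk x y) k z)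

/-- Associativity of the tensor product. -/
def tensorAssoc (X : FinBiset G H) (Y : FinBiset H K) (Z : FinBiset K L) :
    Iso (tensor (tensor X Y) Z) (tensor X (tensor Y Z)) where
  toEquiv :=
    { toFun := tlift (fun t z => assocAux X Y Z z t) (by
        intro t k z
        revert t
        exact tmk_ind fun x y => congrArg (tmk (Y := tensor Y Z) x) (tmk_balanced y k z))
      invFun := tlift (fun x t => assocAux' X Y Z x t) (by
        intro x h t
        revert t
        exact tmk_ind fun y z =>
          congrArg (fun s => tmk (X := tensor X Y) s z) (tmk_balanced x h y))
      left_inv := tmk_ind (by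
        intro t z
        revert t
        exact tmk_ind fun _ _ => rfl)
      right_inv := tmk_ind (by
        intro x t
        revert t
        exact tmk_ind fun _ _ => rfl) }
  map_left g := tmk_ind (by
    intro t z
    revert t
    exact tmk_ind fun _ _ => rfl)
  map_right g := tmk_ind (by
    intro t z
    revert t
    exact tmk_ind fun _ _ => rfl)

/-- The regular biset is neutral on the left. -/
def regularTensor [Finite G] (X : FinBiset G H) : Iso (tensor (regular G) X) X where
  toEquiv :=
    { toFun := tlift (fun (g : G) x => g • x) (fun (g : G) h x => mul_smul g h x)
      invFun := fun x => tmk (X := regular G) (1 : G) x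
      left_inv := tmk_ind fun (g : G) x =>
        ((tmk_balanced (X := regular G) (1 : G) g x).symm.trans
          (congrArg (fun a : G => tmk (X := regular G) a x) (one_mul g)))
      right_inv := fun x => one_smul G x }
  map_left g := tmk_ind fun (a : G) x => mul_smul g a x
  map_right h := tmk_ind fun (a : G) x => smul_comm a h x

/-- The regular biset is neutral on the right. -/
def tensorRegular [Finite H] (X : FinBiset G H) : Iso (tensor X (regular H)) X where
  toEquiv :=
    { toFun := tlift (fun x (h : H) => op h • x) (fun x k (h : H) => by
        change op h • op k • x = op (k * h) • x
        rw [smul_smul, op_mul])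
      invFun := fun x => tmk (Y := regular H) x (1 : H)
      left_inv := tmk_ind fun x (h : H) =>
        ((tmk_balanced (Y := regular H) x h (1 : H)).trans
          (congrArg (fun a : H => tmk (Y := regular H) x a) (mul_one h)))
      right_inv := fun x => one_smul Hᵐᵒᵖ x }
  map_left g := tmk_ind fun x (a : H) => (smul_comm g (op a) x).symm
  map_right h := tmk_ind fun x (a : H) => mul_smul h (op a) x

/-- Taking opposites twice gives back the biset. -/
def oppositeOpposite (X : FinBiset G H) : Iso (opposite (opposite X)) X where
  toEquiv := Equiv.refl X.carrier
  map_left g x := by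
    change (unop (op g⁻¹))⁻¹ • (show X.carrier from x) = g • (show X.carrier from x)
    simp
  map_right h x := by
    change op ((unop h)⁻¹)⁻¹ • (show X.carrier from x) = h • (show X.carrier from x)
    simp

/-- Opposites commute with disjoint unions. -/
def oppositeSum (X Y : FinBiset G H) :
    Iso (opposite (sum X Y)) (sum (opposite X) (opposite Y)) where
  toEquiv := Equiv.refl (X.carrier ⊕ Y.carrier)
  map_left := by rintro h (x | y) <;> rfl
  map_right := by rintro h (x | y) <;> rfl

/-- The opposite of the empty biset is empty. -/
def oppositeEmpty : Iso (opposite (empty G H)) (empty H G) where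
  toEquiv := Equiv.refl PEmpty
  map_left _ x := PEmpty.elim x
  map_right _ x := PEmpty.elim x

/-- Opposites reverse tensor products. -/
def oppositeTensor (X : FinBiset G H) (Y : FinBiset H K) :
    Iso (opposite (tensor X Y)) (tensor (opposite Y) (opposite X)) where
  toEquiv :=
    { toFun := tlift (X := X) (Y := Y)
        (fun x y => tmk (X := opposite Y) (Y := opposite X) y x) (fun x h y => by
          have := tmk_balanced (X := opposite Y) (Y := opposite X) y h⁻¹ x
          change tmk (X := opposite Y) (Y := opposite X) (h⁻¹⁻¹ • y : Y.carrier) x =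
            tmk (X := opposite Y) (Y := opposite X) y (op h⁻¹⁻¹ • x : X.carrier) at this
          rw [inv_inv] at this
          exact this.symm)
      invFun := tlift (X := opposite Y) (Y := opposite X)
        (fun y x => tmk (X := X) (Y := Y) x y) (fun y h x =>
          (tmk_balanced (X := X) (Y := Y) x h⁻¹ y).symm)
      left_inv := tmk_ind (X := X) (Y := Y) fun _ _ => rfl
      right_inv := tmk_ind fun _ _ => rfl }
  map_left _ := tmk_ind (X := X) (Y := Y) fun _ _ => rfl
  map_right _ := tmk_ind (X := X) (Y := Y) fun _ _ => rfl

end Basic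

end FinBiset

/-- Isomorphism classes of finite `(G, H)`-bisets. -/
def BisetClass (G H : Type u) [Group G] [Group H] : Type (u + 1) :=
  Quotient (FinBiset.isoSetoid G H)

namespace BisetClass

open FinBiset

section Basic

variable {G H K L : Type u} [Group G] [Group H] [Group K] [Group L]

/-- The isomorphism class of a finite biset. -/
def mk (X : FinBiset G H) : BisetClass G H := Quotient.mk (isoSetoid G H) X

theorem sound {X Y : FinBiset G H} (e : Iso X Y) : mk X = mk Y := Quotient.sound' ⟨e⟩

theorem ind {P : BisetClass G H → Prop} (h : ∀ X, P (mk X)) (a : BisetClass G H) : P a :=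
  Quotient.ind h a

/-- Isomorphism classes of finite bisets form a commutative monoid under disjoint union. -/
instance : AddCommMonoid (BisetClass G H) :=
  letI : Zero (BisetClass G H) := ⟨mk (empty G H)⟩
  letI : Add (BisetClass G H) := ⟨Quotient.map₂ sum fun _ _ ⟨e⟩ _ _ ⟨f⟩ => ⟨sumCongr e f⟩⟩
  { add_comm := ind fun X => ind fun Y => sound (sumComm X Y)
    add_assoc := ind fun X => ind fun Y => ind fun Z => sound (sumAssoc X Y Z)
    zero_add := ind fun X => sound (emptySum X)
    add_zero := ind fun X => sound ((sumComm X (empty G H)).trans (emptySum X))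
    nsmul := nsmulRec }

/-- The tensor product on isomorphism classes, as a biadditive map. -/
def comp : BisetClass G H →+ BisetClass H K →+ BisetClass G K where
  toFun a :=
    { toFun := fun b =>
        Quotient.lift₂ (s₁ := isoSetoid G H) (s₂ := isoSetoid H K)
          (fun X Y => mk (tensor X Y))
          (fun _ _ _ _ ⟨e⟩ ⟨f⟩ => sound (tensorCongr e f)) a b
      map_zero' := by
        revert a
        exact ind fun X => sound (tensorEmpty X)
      map_add' := by
        revert a
        exact ind fun X => ind fun Y => ind fun Y' => sound (tensorSum X Y Y') }
  map_zero' := AddMonoidHom.ext (ind fun Y => sound (emptyTensor Y))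
  map_add' := ind fun X => ind fun X' =>
    AddMonoidHom.ext (ind fun Y => sound (sumTensor X X' Y))

/-- Taking opposites, as an additive map on isomorphism classes. -/
def opp : BisetClass G H →+ BisetClass H G where
  toFun := Quotient.lift (fun X => mk (opposite X)) fun _ _ ⟨e⟩ => sound (oppositeCongr e)
  map_zero' := sound oppositeEmpty
  map_add' := ind fun X => ind fun Y => sound (oppositeSum X Y)

end Basic

end BisetClass

/-- The group `B(G, H)`: the Grothendieck group of isomorphism classes of finite
`(G, H)`-bisets with respect to disjoint union. -/
def BisetGroup (G H : Type u) [Group G] [Group H] : Type (u + 1) :=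
  Algebra.GrothendieckAddGroup (BisetClass G H)

namespace BisetGroup

section Basic

variable {G H K L : Type u} [Group G] [Group H] [Group K] [Group L]

noncomputable instance : AddCommGroup (BisetGroup G H) :=
  inferInstanceAs (AddCommGroup (Algebra.GrothendieckAddGroup (BisetClass G H)))

/-- The canonical map from isomorphism classes to the Grothendieck group. -/
noncomputable def of : BisetClass G H →+ BisetGroup G H :=
  Algebra.GrothendieckAddGroup.of

/-- The class `[X]` of a finite biset in `B(G, H)`. -/
noncomputable def cls (X : FinBiset G H) : BisetGroup G H := of (BisetClass.mk X)

/-- The universal property of the Grothendieck group. -/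
noncomputable def lift {A : Type*} [AddCommGroup A] (f : BisetClass G H →+ A) :
    BisetGroup G H →+ A :=
  Algebra.GrothendieckAddGroup.lift f

theorem lift_of {A : Type*} [AddCommGroup A] (f : BisetClass G H →+ A) (a : BisetClass G H) :
    lift f (of a) = f a :=
  DFunLike.congr_fun (Algebra.GrothendieckAddGroup.lift.symm_apply_apply f) a

theorem hom_ext {A : Type*} [AddCommGroup A] {f g : BisetGroup G H →+ A}
    (h : ∀ X, f (cls X) = g (cls X)) : f = g :=
  (Algebra.GrothendieckAddGroup.lift (M := BisetClass G H) (G := A)).symm.injective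
    (AddMonoidHom.ext (BisetClass.ind h))

/-- The biadditive map `∘_H : B(G, H) × B(H, K) → B(G, K)` with `[X] ∘_H [Y] = [X ×_H Y]`. -/
noncomputable def comp : BisetGroup G H →+ BisetGroup H K →+ BisetGroup G K :=
  lift
    { toFun := fun a => lift (of.comp (BisetClass.comp a))
      map_zero' := hom_ext fun X => by simp [cls, lift_of]
      map_add' := fun a b => hom_ext fun X => by simp [cls, lift_of] }

theorem comp_cls (X : FinBiset G H) (Y : FinBiset H K) :
    comp (cls X) (cls Y) = cls (FinBiset.tensor X Y) := by
  simp only [comp, cls, lift_of]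
  exact lift_of _ _

/-- The duality `B(G, H) → B(H, G)` with `[X]° = [X°]`. -/
noncomputable def dual : BisetGroup G H →+ BisetGroup H G := lift (of.comp BisetClass.opp)

theorem dual_cls (X : FinBiset G H) : dual (cls X) = cls (FinBiset.opposite X) :=
  lift_of _ _

theorem cls_eq {X Y : FinBiset G H} (e : FinBiset.Iso X Y) : cls X = cls Y :=
  congrArg of (BisetClass.sound e)

theorem induction {P : BisetGroup G H → Prop} (hcls : ∀ X, P (cls X))
    (hsub : ∀ a b, P a → P b → P (a - b)) (a : BisetGroup G H) : P a := by
  let S : AddSubgroup (BisetGroup G H) := AddSubgroup.closure (Set.range cls)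
  have hS : QuotientAddGroup.mk' S = 0 := hom_ext fun X =>
    (QuotientAddGroup.eq_zero_iff _).2 (AddSubgroup.subset_closure ⟨X, rfl⟩)
  have ha : a ∈ S := (QuotientAddGroup.eq_zero_iff a).1 (DFunLike.congr_fun hS a)
  have h0 : P 0 := by
    simpa using hsub _ _ (hcls (FinBiset.empty G H)) (hcls (FinBiset.empty G H))
  have hneg : ∀ b, P b → P (-b) := fun b hb => by simpa using hsub 0 b h0 hb
  refine AddSubgroup.closure_induction (p := fun b _ => P b) ?_ h0 ?_ (fun b _ => hneg b) ha
  · rintro _ ⟨X, rfl⟩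
    exact hcls X
  · intro b c _ _ hb hc
    simpa using hsub b (-c) hb (hneg c hc)

theorem comp_assoc (a : BisetGroup G H) (b : BisetGroup H K) (c : BisetGroup K L) :
    comp (comp a b) c = comp a (comp b c) := by
  induction a using induction with
  | hsub a a' h h' => simp [h, h']
  | hcls X =>
    induction b using induction with
    | hsub b b' h h' => simp [h, h']
    | hcls Y =>
      induction c using induction with
      | hsub c c' h h' => simp [h, h']
      | hcls Z =>
        simp only [comp_cls]
        exact cls_eq (FinBiset.tensorAssoc X Y Z)

theorem dual_comp (a : BisetGroup G H) (b : BisetGroup H K) :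
    dual (comp a b) = comp (dual b) (dual a) := by
  induction a using induction with
  | hsub a a' h h' => simp [h, h']
  | hcls X =>
    induction b using induction with
    | hsub b b' h h' => simp [h, h']
    | hcls Y =>
      simp only [comp_cls, dual_cls]
      exact cls_eq (FinBiset.oppositeTensor X Y)

theorem dual_dual (a : BisetGroup G H) : dual (dual a) = a := by
  induction a using induction with
  | hsub a a' h h' => simp [h, h']
  | hcls X =>
    simp only [dual_cls]
    exact cls_eq (FinBiset.oppositeOpposite X)

theorem id_comp [Finite G] (a : BisetGroup G H) : comp (cls (FinBiset.regular G)) a = a := by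
  induction a using induction with
  | hsub a a' h h' => simp [h, h']
  | hcls X => exact (comp_cls _ _).trans (cls_eq (FinBiset.regularTensor X))

theorem comp_id [Finite H] (a : BisetGroup G H) : comp a (cls (FinBiset.regular H)) = a := by
  induction a using induction with
  | hsub a a' h h' => simp [h, h']
  | hcls X => exact (comp_cls _ _).trans (cls_eq (FinBiset.tensorRegular X))

end Basic

end BisetGroup

/-- The double Burnside ring `B(G, G)`. -/
abbrev DoubleBurnsideRing (G : Type u) [Group G] : Type (u + 1) := BisetGroup G G

namespace DoubleBurnsideRing

variable (G : Type u) [Group G] [Finite G]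

/-- The ring structure on `B(G, G)`: the product is `∘_G`, the identity is `[G]`. -/
noncomputable instance instRing : Ring (DoubleBurnsideRing G) where
  __ := (inferInstance : AddCommGroup (BisetGroup G G))
  mul a b := BisetGroup.comp a b
  one := BisetGroup.cls (FinBiset.regular G)
  left_distrib a b c := map_add (BisetGroup.comp a) b c
  right_distrib a b c := by
    change BisetGroup.comp (a + b) c = BisetGroup.comp a c + BisetGroup.comp b c
    rw [map_add, AddMonoidHom.add_apply]
  zero_mul a := by
    change BisetGroup.comp 0 a = 0
    rw [map_zero, AddMonoidHom.zero_apply]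
  mul_zero a := map_zero (BisetGroup.comp a)
  mul_assoc a b c := BisetGroup.comp_assoc a b c
  one_mul a := BisetGroup.id_comp a
  mul_one a := BisetGroup.comp_id a

/-- Taking opposite bisets is an anti-involution of the ring `B(G, G)`; `star a` is `a°`. -/
noncomputable instance instStarRing : StarRing (DoubleBurnsideRing G) where
  star a := BisetGroup.dual a
  star_involutive a := BisetGroup.dual_dual a
  star_mul a b := BisetGroup.dual_comp a b
  star_add a b := map_add BisetGroup.dual a b

/-- The group `B_∘(G, G)` of orthogonal units: the units `u` with `u u° = u° u = Id`. -/
def orthogonalUnits : Subgroup (DoubleBurnsideRing G)ˣ where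
  carrier := {u | (u : DoubleBurnsideRing G) * star (u : DoubleBurnsideRing G) = 1 ∧
    star (u : DoubleBurnsideRing G) * (u : DoubleBurnsideRing G) = 1}
  one_mem' := by simp
  mul_mem' := by
    rintro u v ⟨hu, hu'⟩ ⟨hv, hv'⟩
    refine ⟨?_, ?_⟩
    · rw [Units.val_mul, star_mul, mul_assoc, ← mul_assoc (v : DoubleBurnsideRing G), hv,
        one_mul, hu]
    · rw [Units.val_mul, star_mul, mul_assoc, ← mul_assoc (star (u : DoubleBurnsideRing G)),
        hu', one_mul, hv']
  inv_mem' := by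
    rintro u ⟨hu, hu'⟩
    have h : ((u⁻¹ : (DoubleBurnsideRing G)ˣ) : DoubleBurnsideRing G)
        = star (u : DoubleBurnsideRing G) := Units.inv_eq_of_mul_eq_one_right hu
    refine ⟨?_, ?_⟩ <;> simp only [h, star_star]
    · exact hu'
    · exact hu

end DoubleBurnsideRing

/-! Over a group `G` of prime order `p`, each point of a biset lies in a copy of a twisted biset
`twist φ` with `φ` in `Aut G`, or of a product `A × B` with `A`, `B` among the `G`-sets `G` and `1`
(`exists_emb`). Hence `B(G, G)` is `ℤ[Aut G]` plus the ideal spanned by the products, which factor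
through the trivial group.

The vectors `[G] - [1]` and `[1]` are orthogonal for the pairing by orbit counting, with squares `p
- 1` and `1`. In the resulting basis the ideal consists of the integer matrices of size 2, with
product `M D N`, where `D = diag (p - 1, 1)`, and with transposition as duality (`ofMatrix_mul`,
`star_ofMatrix`). Twisted bisets act on the ideal as the identity (`tw_mul_unit`).

If `u = ∑ n φ • φ + M` is orthogonal, the coefficient of the identity in `u u°` is the sum of the `n
φ ^ 2`, which must be `1`. So `u = ±(φ + M) = ±φ (1 + M)`, the three factors commute, and the group
is `{±1} × Aut G × T` with `T` the group of orthogonal elements `1 + M`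
(`nonempty_orthogonalUnits_mulEquiv`). It remains to solve `M + Mᵀ + M D Mᵀ = 0` and its companion
over `ℤ`; this makes `1 + M D` an isometry of a form with diagonal Gram matrix. For `p = 2` these
are the eight signed permutation matrices. For `p > 2` they are diagonal with entries `±1`, and a
sign `-1` in the first place requires `p - 1` to divide `2`, that is, `p = 3`. -/

namespace FinBiset

open MulOpposite

variable {G H K : Type u} [Group G] [Group H] [Group K]

/-! ### Splitting off a sub-biset -/

/-- An injective map of bisets. -/
structure Emb (X Y : FinBiset G H) where
  /-- the underlying map -/
  toFun : X.carrier → Y.carrier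
  injective : Function.Injective toFun
  map_left : ∀ (g : G) (x : X.carrier), toFun (g • x) = g • toFun x
  map_right : ∀ (h : Hᵐᵒᵖ) (x : X.carrier), toFun (h • x) = h • toFun x

namespace Emb

variable {X Y : FinBiset G H} (f : Emb X Y)

theorem left_notMem_range (g : G) {y : Y.carrier} (hy : y ∉ Set.range f.toFun) :
    g • y ∉ Set.range f.toFun := by
  rintro ⟨x, hx⟩
  exact hy ⟨g⁻¹ • x, by rw [f.map_left, hx, inv_smul_smul]⟩

theorem right_notMem_range (h : Hᵐᵒᵖ) {y : Y.carrier} (hy : y ∉ Set.range f.toFun) :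
    h • y ∉ Set.range f.toFun := by
  rintro ⟨x, hx⟩
  exact hy ⟨h⁻¹ • x, by rw [f.map_right, hx, inv_smul_smul]⟩

/-- The complement of the range of an injective map of bisets. -/
def compl : FinBiset G H :=
  letI left : MulAction G {y : Y.carrier // y ∉ Set.range f.toFun} :=
    { smul := fun g y => ⟨g • y.1, f.left_notMem_range g y.2⟩
      one_smul := fun y => Subtype.ext (one_smul G y.1)
      mul_smul := fun a b y => Subtype.ext (mul_smul a b y.1) }
  letI right : MulAction Hᵐᵒᵖ {y : Y.carrier // y ∉ Set.range f.toFun} :=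
    { smul := fun h y => ⟨h • y.1, f.right_notMem_range h y.2⟩
      one_smul := fun y => Subtype.ext (one_smul Hᵐᵒᵖ y.1)
      mul_smul := fun a b y => Subtype.ext (mul_smul a b y.1) }
  { carrier := {y : Y.carrier // y ∉ Set.range f.toFun}
    left := left
    right := right
    comm := @SMulCommClass.mk G Hᵐᵒᵖ _ left.toSMul right.toSMul
      fun g h y => Subtype.ext (smul_comm g h y.1) }

/-- A biset is the disjoint union of the source of an injective map and of the complement of its
range. -/
noncomputable def sumCompl : Iso (sum X f.compl) Y where
  toEquiv := Equiv.ofBijective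
    (fun s : X.carrier ⊕ {y : Y.carrier // y ∉ Set.range f.toFun} =>
      Sum.elim f.toFun Subtype.val s) (by
    constructor
    · rintro (x | ⟨y, hy⟩) (x' | ⟨y', hy'⟩) h
      · exact congrArg Sum.inl (f.injective h)
      · exact (hy' ⟨x, h⟩).elim
      · exact (hy ⟨x', h.symm⟩).elim
      · exact congrArg Sum.inr (Subtype.ext h)
    · intro y
      by_cases hy : y ∈ Set.range f.toFun
      · obtain ⟨x, rfl⟩ := hy
        exact ⟨Sum.inl x, rfl⟩
      · exact ⟨Sum.inr ⟨y, hy⟩, rfl⟩)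
  map_left := by
    rintro g (x | y)
    · exact f.map_left g x
    · rfl
  map_right := by
    rintro h (x | y)
    · exact f.map_right h x
    · rfl

/-- This strict decrease drives the induction of `mem_of_emb`. -/
theorem card_compl_lt [Nonempty X.carrier] :
    Nat.card f.compl.carrier < Nat.card Y.carrier := by
  have h := Nat.card_congr f.sumCompl.toEquiv
  have hs : Nat.card (sum X f.compl).carrier = Nat.card X.carrier + Nat.card f.compl.carrier :=
    Nat.card_sum
  have hX : 0 < Nat.card X.carrier := Nat.card_pos
  omega

end Emb

/-! ### Twisted bisets and products of `G`-sets -/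

/-- The biset `G` with the left multiplication action and the right action `x · h = x * φ h`. -/
def twist [Finite G] (φ : MulAut G) : FinBiset G G :=
  letI right : MulAction Gᵐᵒᵖ G := MulAction.compHom G (MonoidHom.op φ.toMonoidHom)
  { carrier := G
    left := Monoid.toMulAction G
    right := right
    comm := @SMulCommClass.mk G Gᵐᵒᵖ G _ right.toSMul
      fun a b x => (mul_assoc a x (φ (unop b))).symm }

theorem twist_left [Finite G] (φ : MulAut G) (g : G) (x : (twist φ).carrier) :
    g • x = (g * (show G from x) : G) := rfl

theorem twist_right [Finite G] (φ : MulAut G) (h : G) (x : (twist φ).carrier) :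
    op h • x = ((show G from x) * φ h : G) := rfl

/-- The twist by the identity is the regular biset. -/
def twistOne [Finite G] : Iso (twist (1 : MulAut G)) (regular G) :=
  ⟨Equiv.refl G, fun _ _ => rfl, fun _ _ => rfl⟩

/-- The tensor product of twisted bisets. -/
def twistTensor [Finite G] (φ ψ : MulAut G) :
    Iso (tensor (twist φ) (twist ψ)) (twist (φ * ψ)) where
  toEquiv :=
    { toFun := tlift (fun (x y : G) => (x * φ y : G)) (fun (x : G) h (y : G) => by
        change x * φ h * φ y = x * φ (h * y)
        rw [map_mul, mul_assoc])
      invFun := fun x => tmk (X := twist φ) (Y := twist ψ) x (1 : G)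
      left_inv := tmk_ind fun (x y : G) =>
        (tmk_balanced (X := twist φ) (Y := twist ψ) x y (1 : G)).trans
          (congrArg (fun a : G => tmk (X := twist φ) (Y := twist ψ) x a) (mul_one y))
      right_inv := fun (x : G) => by
        change x * φ 1 = x
        rw [map_one, mul_one] }
  map_left g := tmk_ind fun (x y : G) => mul_assoc g x (φ y)
  map_right k := tmk_ind fun (x y : G) => by
    change x * φ (y * ψ (unop k)) = x * φ y * φ (ψ (unop k))
    rw [map_mul, mul_assoc]

/-- The opposite of a twisted biset. -/
def twistOpposite [Finite G] (φ : MulAut G) : Iso (opposite (twist φ)) (twist φ⁻¹) where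
  toEquiv := (Equiv.inv G).trans φ.symm.toEquiv
  map_left g (x : G) := by
    change φ.symm (x * φ g⁻¹)⁻¹ = g * φ.symm x⁻¹
    simp
  map_right g (x : G) := by
    change φ.symm ((unop g)⁻¹ * x)⁻¹ = φ.symm x⁻¹ * φ.symm (unop g)
    simp

/-- A finite `G`-set as a biset for `G` and the trivial group. -/
def ofSet (A : Type u) [Finite A] [MulAction G A] : FinBiset G PUnit.{u + 1} :=
  letI right : MulAction PUnit.{u + 1}ᵐᵒᵖ A :=
    { smul := fun _ x => x, one_smul := fun _ => rfl, mul_smul := fun _ _ _ => rfl }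
  { carrier := A
    right := right
    comm := @SMulCommClass.mk G PUnit.{u + 1}ᵐᵒᵖ A _ right.toSMul fun _ _ _ => rfl }

/-- The `(G, G)`-biset `A × B`, for finite left `G`-sets `A` and `B`. -/
def box (A B : Type u) [Finite A] [Finite B] [MulAction G A] [MulAction G B] : FinBiset G G :=
  tensor (ofSet A) (opposite (ofSet B))

section Box

variable {A B : Type u} [Finite A] [Finite B] [MulAction G A] [MulAction G B]

/-- The class of a pair in `A × B`. -/
def bmk (a : A) (b : B) : (box (G := G) A B).carrier :=
  tmk (X := ofSet A) (Y := opposite (ofSet B)) a b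

theorem bmk_ind {P : (box (G := G) A B).carrier → Prop} (h : ∀ a b, P (bmk a b))
    (t : (box (G := G) A B).carrier) : P t :=
  tmk_ind (X := ofSet A) (Y := opposite (ofSet B)) h t

/-- Maps from `A × B` are given on pairs. -/
def blift {T : Type*} (F : A → B → T) : (box (G := G) A B).carrier → T :=
  tlift (X := ofSet A) (Y := opposite (ofSet B)) F (fun _ _ _ => rfl)

end Box

end FinBiset

namespace FinBiset

open MulOpposite

variable {G : Type u} [Group G]

/-! ### Orbits of bisets over a group of prime order -/

/-- An embedding of `A × B` from a map on pairs. -/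
def boxEmb {A B : Type u} [Finite A] [Finite B] [MulAction G A] [MulAction G B]
    {X : FinBiset G G} (F : A → B → X.carrier)
    (hinj : ∀ a b a' b', F a b = F a' b' → a = a' ∧ b = b')
    (hleft : ∀ (g : G) a b, F (g • a) b = g • F a b)
    (hright : ∀ (g : G) a b, F a (g⁻¹ • b) = op g • F a b) : Emb (box A B) X where
  toFun := blift F
  injective := bmk_ind fun a b => bmk_ind fun a' b' h => by
    obtain ⟨rfl, rfl⟩ := hinj a b a' b' h
    rfl
  map_left g := bmk_ind fun a b => hleft g a b
  map_right g := bmk_ind fun a b => hright (unop g) a b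

/-- An action of a group of prime order is trivial or free at each point. -/
theorem fixed_or_free {M : Type*} [Group M] (hM : (Nat.card M).Prime) {α : Type*}
    [MulAction M α] (x : α) : (∀ g : M, g • x = x) ∨ (∀ g : M, g • x = x → g = 1) := by
  have : Fact (Nat.card M).Prime := ⟨hM⟩
  rcases (MulAction.stabilizer M x).eq_bot_or_eq_top_of_prime_card with h | h
  · right
    intro g hg
    have : g ∈ MulAction.stabilizer M x := hg
    rwa [h, Subgroup.mem_bot] at this
  · left
    intro g
    have : g ∈ MulAction.stabilizer M x := h ▸ Subgroup.mem_top g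
    exact this

theorem mul_comm_of_prime_card (hG : (Nat.card G).Prime) (a b : G) : a * b = b * a := by
  have : Fact (Nat.card G).Prime := ⟨hG⟩
  have : IsCyclic G := isCyclic_of_prime_card (p := Nat.card G) rfl
  exact (IsCyclic.commGroup (α := G)).mul_comm a b

variable [Finite G]

/-- The elements `h` such that `x * h` lies in the left orbit of `x`. -/
def matching (X : FinBiset G G) (x : X.carrier) : Subgroup G where
  carrier := {h | ∃ g : G, g • x = op h • x}
  one_mem' := ⟨1, by simp⟩
  mul_mem' := by
    rintro h h' ⟨g, hg⟩ ⟨g', hg'⟩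
    exact ⟨g * g', by rw [mul_smul, hg', smul_comm, hg, op_mul, mul_smul]⟩
  inv_mem' := by
    rintro h ⟨g, hg⟩
    refine ⟨g⁻¹, ?_⟩
    rw [inv_smul_eq_iff, smul_comm, hg, op_inv, inv_smul_smul]

/-- Over a group of prime order, a nonempty biset contains a twisted biset or one of the
products of the sets `G` and `1`. -/
theorem exists_emb (hG : (Nat.card G).Prime) (X : FinBiset G G) (x : X.carrier) :
    (∃ φ : MulAut G, Nonempty (Emb (twist φ) X)) ∨ Nonempty (Emb (box G G) X) ∨
    Nonempty (Emb (box G PUnit.{u + 1}) X) ∨ Nonempty (Emb (box PUnit.{u + 1} G) X) ∨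
    Nonempty (Emb (box PUnit.{u + 1} PUnit.{u + 1}) X) := by
  have hcomm := mul_comm_of_prime_card hG
  have hG' : (Nat.card Gᵐᵒᵖ).Prime := by rwa [← Nat.card_congr (opEquiv (α := G))]
  -- Each of the two actions is trivial or free at `x`. If one of them is trivial, the orbit is a
  -- product; only the doubly free case needs the subgroup `matching`.
  rcases fixed_or_free hG x with hl | hl <;> rcases fixed_or_free hG' x with hr | hr
  · exact Or.inr <| Or.inr <| Or.inr <| Or.inr
      ⟨boxEmb (fun _ _ => x) (fun _ _ _ _ _ => ⟨rfl, rfl⟩) (fun g _ _ => (hl g).symm)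
        (fun g _ _ => (hr (op g)).symm)⟩
  · refine Or.inr <| Or.inr <| Or.inr <| Or.inl
      -- The second factor of a product is an opposite set, on which the right action is by
      -- inverses; hence `b⁻¹`.
      ⟨boxEmb (fun _ (b : G) => op b⁻¹ • x) (fun _ b _ b' h => ⟨rfl, ?_⟩) (fun g _ b => ?_)
        (fun g _ b => ?_)⟩
    · have := hr ((op b'⁻¹)⁻¹ * op b⁻¹) (by rw [mul_smul, h, inv_smul_smul])
      simpa [mul_inv_eq_one, eq_comm] using this
    · rw [smul_comm, hl]
    · simp [smul_smul]
  · refine Or.inr <| Or.inr <| Or.inl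
      ⟨boxEmb (fun (a : G) _ => a • x) (fun a _ a' _ h => ⟨?_, rfl⟩) (fun g a _ => ?_)
        (fun g a _ => ?_)⟩
    · have := hl (a'⁻¹ * a) (by rw [mul_smul, h, inv_smul_smul])
      exact (inv_mul_eq_one.1 this).symm
    · exact mul_smul g a x
    · rw [← smul_comm, hr]
  · have hl' : ∀ a b : G, a • x = b • x → a = b := fun a b h =>
      (inv_mul_eq_one.1 (hl (b⁻¹ * a) (by rw [mul_smul, h, inv_smul_smul]))).symm
    have : Fact (Nat.card G).Prime := ⟨hG⟩
    -- If `matching` is trivial, left and right translates of `x` are independent and the orbit is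
    -- `G × G`. If it is everything, the left and right orbits of `x` coincide.
    rcases (matching X x).eq_bot_or_eq_top_of_prime_card with h | h
    · refine Or.inr <| Or.inl
        ⟨boxEmb (fun a b : G => a • op b⁻¹ • x) (fun a b a' b' e => ?_) (fun g a b => ?_)
          (fun g a b => ?_)⟩
      · have hb : b'⁻¹ * b ∈ matching X x := by
          refine ⟨a'⁻¹ * a, ?_⟩
          have h1 : a • x = op b • a' • op b'⁻¹ • x := by
            rw [← e, ← smul_comm a, smul_smul (op b), ← op_mul, inv_mul_cancel, op_one, one_smul]
          rw [mul_smul, h1, ← smul_comm a' (op b), inv_smul_smul, smul_smul, ← op_mul]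
        rw [h, Subgroup.mem_bot, inv_mul_eq_one] at hb
        subst hb
        rw [smul_comm, smul_comm a'] at e
        exact ⟨hl' _ _ (smul_left_cancel _ e), rfl⟩
      · exact mul_smul g a _
      · rw [← smul_comm a (op g), smul_smul (op g), ← op_mul]
        simp
    -- Since the left action is free at `x`, the element `φ k` with `φ k • x = x · k` is unique,
    -- which makes `φ` a homomorphism; it is injective because the right action is free at `x`.
    · have hφ : ∀ k : G, ∃ g : G, g • x = op k • x := fun k => by
        have : k ∈ matching X x := h ▸ Subgroup.mem_top k
        exact this
      choose φ hφ using hφ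
      let Φ : G →* G := MonoidHom.mk' φ fun a b => hl' _ _ <| by
        rw [hφ, mul_smul, hφ, smul_comm, hφ, smul_smul, op_mul]
      have hΦ : Function.Bijective Φ := by
        refine Finite.injective_iff_bijective.1 fun a b (hab : φ a = φ b) => ?_
        have := hr ((op b)⁻¹ * op a) (by rw [mul_smul, ← hφ a, hab, hφ b, inv_smul_smul])
        exact (op_injective (inv_mul_eq_one.1 this)).symm
      refine Or.inl ⟨MulEquiv.ofBijective Φ hΦ, ⟨fun y : G => y • x, hl', fun g y => ?_,
        fun k y => ?_⟩⟩
      · exact mul_smul g y x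
      · change ((show G from y) * φ (unop k)) • x = k • (show G from y) • x
        rw [mul_smul, hφ, smul_comm]
        rfl

end FinBiset

namespace BisetGroup

open MulOpposite FinBiset

/-! ### Counting homomorphisms on the Grothendieck group -/

section Count

variable {G H : Type u} [Group G] [Group H]

/-- The number of elements with a property that is stable under isomorphisms and compatible with
disjoint unions, as a homomorphism on `B(G, H)`. -/
noncomputable def count (P : ∀ X : FinBiset G H, X.carrier → Prop)
    (hiso : ∀ {X Y : FinBiset G H} (e : Iso X Y) (x), P X x → P Y (e.toEquiv x))
    (hinl : ∀ (X Y : FinBiset G H) x, P (FinBiset.sum X Y) (Sum.inl x) ↔ P X x)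
    (hinr : ∀ (X Y : FinBiset G H) y, P (FinBiset.sum X Y) (Sum.inr y) ↔ P Y y) :
    BisetGroup G H →+ ℤ :=
  lift (AddMonoidHom.comp (Nat.castAddMonoidHom ℤ)
    { toFun := Quotient.lift (s := isoSetoid G H) (fun X => Nat.card {x // P X x})
        fun X Y ⟨e⟩ => Nat.card_congr (e.toEquiv.subtypeEquiv fun x => ⟨hiso e x, fun h => by
          have := hiso e.symm _ h
          rwa [show e.symm.toEquiv (e.toEquiv x) = x from e.toEquiv.symm_apply_apply x] at this⟩)
      map_zero' := by
        have : IsEmpty {x // P (FinBiset.empty G H) x} := ⟨fun x => PEmpty.elim x.1⟩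
        exact Nat.card_of_isEmpty (α := {x // P (FinBiset.empty G H) x})
      map_add' := BisetClass.ind fun X => BisetClass.ind fun Y => by
        change Nat.card {x // P (FinBiset.sum X Y) x} =
          Nat.card {x // P X x} + Nat.card {x // P Y x}
        rw [← Nat.card_sum]
        exact Nat.card_congr (Equiv.trans Equiv.subtypeSum
          (Equiv.sumCongr (Equiv.subtypeEquivRight (hinl X Y))
            (Equiv.subtypeEquivRight (hinr X Y)))) })

theorem count_cls (P : ∀ X : FinBiset G H, X.carrier → Prop) (hiso) (hinl) (hinr)
    (X : FinBiset G H) :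
    count P hiso hinl hinr (cls X) = Nat.card {x // P X x} :=
  lift_of _ _

theorem cls_empty_carrier (X : FinBiset G H) [IsEmpty X.carrier] : cls X = 0 := by
  have e : Iso X (FinBiset.empty G H) :=
    ⟨Equiv.equivOfIsEmpty X.carrier PEmpty, fun _ x => isEmptyElim x, fun _ x => isEmptyElim x⟩
  rw [cls_eq e]
  exact map_zero of

theorem cls_eq_add_compl {X Y : FinBiset G H} (f : Emb X Y) : cls Y = cls X + cls f.compl := by
  rw [← cls_eq f.sumCompl]
  exact map_add of (BisetClass.mk X) (BisetClass.mk f.compl)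

/-- The number of elements of a biset. -/
noncomputable def card : BisetGroup G H →+ ℤ :=
  count (fun _ _ => True) (fun _ _ h => h) (fun _ _ _ => Iff.rfl) (fun _ _ _ => Iff.rfl)

theorem card_cls (X : FinBiset G H) : card (cls X) = Nat.card X.carrier := by
  rw [card, count_cls]
  exact congrArg _ (Nat.card_congr (Equiv.subtypeUnivEquiv fun _ => trivial))

end Count

section Twisted

variable {G : Type u} [Group G]

/-- The number of elements `x` not fixed by the left action and with `φ h · x = x · h`
for all `h`. -/
noncomputable def twistedCount (φ : MulAut G) : BisetGroup G G →+ ℤ :=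
  -- The second condition discards the points of products, some of which satisfy the first one. The
  -- count then vanishes on the ideal and detects the coefficient of `twist φ`.
  count (fun _ x => (∀ h : G, φ h • x = op h • x) ∧ ¬ ∀ g : G, g • x = x)
    (fun e x ⟨h, h'⟩ => ⟨fun k => by rw [← e.map_left, ← e.map_right, h], fun k => h' fun g =>
      e.toEquiv.injective (by rw [e.map_left, k])⟩)
    (fun _ _ _ => and_congr (forall_congr' fun _ => Sum.inl_injective.eq_iff)
      (not_congr (forall_congr' fun _ => Sum.inl_injective.eq_iff)))
    (fun _ _ _ => and_congr (forall_congr' fun _ => Sum.inr_injective.eq_iff)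
      (not_congr (forall_congr' fun _ => Sum.inr_injective.eq_iff)))

/-- Only the trivial group is divided out, so equal classes have equal first coordinates. A class
satisfying the first condition thus has `φ h • x = x` for all `h`; as `φ` is onto, `G` fixes `x` and
the class, against the second condition. -/
theorem twistedCount_tensor (φ : MulAut G) (X : FinBiset G PUnit.{u + 1})
    (Y : FinBiset PUnit.{u + 1} G) : twistedCount φ (cls (tensor X Y)) = 0 := by
  rw [twistedCount, count_cls, Nat.cast_eq_zero]
  have : IsEmpty {t : (tensor X Y).carrier //
      (∀ h : G, φ h • t = op h • t) ∧ ¬ ∀ g : G, g • t = t} := by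
    constructor
    rintro ⟨t, h, h'⟩
    revert t
    refine tmk_ind fun x y h h' => h' fun g => ?_
    obtain ⟨k, hk⟩ := Quotient.exact (h (φ.symm g))
    have hx := congrArg Prod.fst hk
    change x = op k⁻¹ • φ (φ.symm g) • x at hx
    rw [Subsingleton.elim (op k⁻¹) 1, one_smul, MulEquiv.apply_symm_apply] at hx
    rw [left_tmk, ← hx]
  exact Nat.card_of_isEmpty

theorem twistedCount_comp (φ : MulAut G) (v : BisetGroup G PUnit.{u + 1})
    (w : BisetGroup PUnit.{u + 1} G) : twistedCount φ (comp v w) = 0 := by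
  induction v using induction with
  | hsub a b ha hb => rw [map_sub, AddMonoidHom.sub_apply, map_sub, ha, hb, sub_zero]
  | hcls X =>
    induction w using induction with
    | hsub a b ha hb => rw [map_sub, map_sub, ha, hb, sub_zero]
    | hcls Y => rw [comp_cls, twistedCount_tensor]

variable [Finite G]

/-- As `G` is commutative, `φ h * x = x * ψ h` holds for all `h` only if `φ = ψ`, whatever `x` is;
the left action has no fixed point. So either all points count or none does. -/
theorem twistedCount_twist [DecidableEq (MulAut G)] (hG : (Nat.card G).Prime) (φ ψ : MulAut G) :
    twistedCount φ (cls (twist ψ)) = if φ = ψ then (Nat.card G : ℤ) else 0 := by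
  have hcomm := mul_comm_of_prime_card hG
  rw [twistedCount, count_cls]
  have hx : ∀ x : (twist ψ).carrier, ((∀ h : G, φ h • x = op h • x) ∧ ¬ ∀ g : G, g • x = x) ↔
      φ = ψ := by
    intro x
    constructor
    · rintro ⟨h, -⟩
      ext k
      have := h k
      rw [twist_left, twist_right, hcomm] at this
      exact mul_left_cancel this
    · rintro rfl
      refine ⟨fun h => ?_, fun h => ?_⟩
      · rw [twist_left, twist_right, hcomm]
      · have : Nontrivial G := Finite.one_lt_card_iff_nontrivial.1 hG.one_lt
        obtain ⟨g, hg⟩ := exists_ne (1 : G)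
        exact hg (mul_eq_right.1 (h g))
  rw [Nat.card_congr (Equiv.subtypeEquivRight hx)]
  split_ifs with h
  · exact congrArg _ (Nat.card_congr (Equiv.subtypeUnivEquiv fun _ => h))
  · have : IsEmpty {_x : (twist ψ).carrier // φ = ψ} := ⟨fun x => h x.2⟩
    simp

end Twisted

end BisetGroup

namespace FinBiset

open MulOpposite

variable {G : Type u} [Group G] [Finite G]

/-! ### Composition with the `G`-sets `G` and `1` -/

/-- Twisting the regular `G`-set gives the regular `G`-set. -/
def twistOfSetSelf (φ : MulAut G) : Iso (tensor (twist φ) (ofSet (G := G) G)) (ofSet G) where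
  toEquiv :=
    { toFun := tlift (fun (x a : G) => (x * φ a : G)) (fun (x : G) h (a : G) => by
        change x * φ h * φ a = x * φ (h * a)
        rw [map_mul, mul_assoc])
      invFun := fun x => tmk (X := twist φ) (Y := ofSet G) x (1 : G)
      left_inv := tmk_ind fun (x a : G) =>
        (tmk_balanced (X := twist φ) (Y := ofSet G) x a (1 : G)).trans
          (congrArg (fun b : G => tmk (X := twist φ) (Y := ofSet (G := G) G) x b) (mul_one a))
      right_inv := fun (x : G) => by
        change x * φ 1 = x
        rw [map_one, mul_one] }
  map_left g := tmk_ind fun (x a : G) => mul_assoc g x (φ a)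
  map_right _ := tmk_ind fun (_ _ : G) => rfl

/-- Twisting the trivial `G`-set gives the trivial `G`-set. -/
def twistOfSetPUnit (φ : MulAut G) :
    Iso (tensor (twist φ) (ofSet (G := G) PUnit.{u + 1})) (ofSet PUnit.{u + 1}) where
  toEquiv :=
    { toFun := fun _ => PUnit.unit
      invFun := fun _ => tmk (X := twist φ) (Y := ofSet PUnit.{u + 1}) (1 : G) PUnit.unit
      left_inv := tmk_ind fun (x : G) _ => by
        have h := tmk_balanced (X := twist φ) (Y := ofSet (G := G) PUnit.{u + 1})
          (1 : G) (φ.symm x) PUnit.unit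
        refine h.symm.trans
          (congrArg (fun y : G => tmk (X := twist φ) (Y := ofSet (G := G) PUnit.{u + 1}) y
            PUnit.unit) ?_)
        change 1 * φ (φ.symm x) = x
        rw [MulEquiv.apply_symm_apply, one_mul]
      right_inv := fun _ => rfl }
  map_left _ _ := rfl
  map_right _ _ := rfl

/-- The product over `G` of the regular `G`-set with a `G`-set `B` is `B`. -/
def selfTensorEquiv (B : Type u) [Finite B] [MulAction G B] :
    (tensor (opposite (ofSet (G := G) G)) (ofSet B)).carrier ≃ B where
  toFun := tlift (X := opposite (ofSet (G := G) G)) (Y := ofSet B)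
    (fun (a : G) (b : B) => a⁻¹ • b) (fun (x : G) h (b : B) => by
      change (h⁻¹ * x)⁻¹ • b = x⁻¹ • h • b
      rw [mul_inv_rev, inv_inv, mul_smul])
  invFun b := tmk (X := opposite (ofSet (G := G) G)) (Y := ofSet B) (1 : G) b
  left_inv := tmk_ind (X := opposite (ofSet (G := G) G)) (Y := ofSet B) fun (a : G) (b : B) => by
    refine (tmk_balanced (X := opposite (ofSet (G := G) G)) (Y := ofSet B)
      (1 : G) a⁻¹ b).symm.trans ?_
    refine congrArg (fun c : G => tmk (X := opposite (ofSet (G := G) G)) (Y := ofSet B) c b) ?_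
    change a⁻¹⁻¹ * 1 = a
    rw [inv_inv, mul_one]
  right_inv (b : B) := by
    change (1 : G)⁻¹ • b = b
    rw [inv_one, one_smul]

-- The product of the trivial `G`-set with `B` over `G` is the set of orbits of `B`.
omit [Finite G] in
theorem card_punit_tensor (B : Type u) [Finite B] [Nonempty B] [MulAction G B]
    [MulAction.IsPretransitive G B] :
    Nat.card (tensor (opposite (ofSet (G := G) PUnit.{u + 1})) (ofSet B)).carrier = 1 := by
  obtain ⟨b₀⟩ := ‹Nonempty B›
  rw [Nat.card_eq_one_iff_unique]
  have key : ∀ t : (tensor (opposite (ofSet (G := G) PUnit.{u + 1})) (ofSet B)).carrier,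
      t = tmk (X := opposite (ofSet (G := G) PUnit.{u + 1})) (Y := ofSet B) PUnit.unit b₀ :=
    tmk_ind fun _ b => by
      obtain ⟨g, rfl⟩ := MulAction.exists_smul_eq G b₀ b
      exact (tmk_balanced (X := opposite (ofSet (G := G) PUnit.{u + 1})) (Y := ofSet B)
        PUnit.unit g b₀).symm
  exact ⟨⟨fun t t' => (key t).trans (key t').symm⟩,
    ⟨tmk (X := opposite (ofSet (G := G) PUnit.{u + 1})) (Y := ofSet B) PUnit.unit b₀⟩⟩

end FinBiset

namespace BisetGroup

open MulOpposite FinBiset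

/-- Strong induction on the cardinality: remove a nonempty sub-biset with class in `S` and apply the
hypothesis to its complement. -/
theorem mem_of_emb {G H : Type u} [Group G] [Group H] (S : AddSubgroup (BisetGroup G H))
    (h : ∀ (X : FinBiset G H), X.carrier → ∃ (T : FinBiset G H) (_ : Emb T X),
      Nonempty T.carrier ∧ cls T ∈ S) (a : BisetGroup G H) : a ∈ S := by
  have key : ∀ n, ∀ X : FinBiset G H, Nat.card X.carrier = n → cls X ∈ S := by
    intro n
    induction n using Nat.strong_induction_on with
    | _ n ih =>
      rintro X rfl
      rcases isEmpty_or_nonempty X.carrier with hX | ⟨⟨x⟩⟩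
      · rw [cls_empty_carrier]
        exact S.zero_mem
      · obtain ⟨T, f, hT, hTS⟩ := h X x
        rw [cls_eq_add_compl f]
        exact S.add_mem hTS (ih _ f.card_compl_lt _ rfl)
  induction a using induction with
  | hsub a b ha hb => exact S.sub_mem ha hb
  | hcls X => exact key _ X rfl

theorem card_one : card (cls (regular PUnit.{u + 1})) = 1 := by
  rw [card_cls]
  exact_mod_cast Nat.card_unique (α := PUnit.{u + 1})

/-- A biset over the trivial group is a set, so `B(1, 1)` is `ℤ` and the composites `v° ∘ w` may be
read as integers. -/
theorem eq_card_zsmul (a : BisetGroup PUnit.{u + 1} PUnit.{u + 1}) :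
    a = card a • cls (regular PUnit.{u + 1}) := by
  have h : a ∈ AddSubgroup.zmultiples (cls (regular PUnit.{u + 1})) := by
    refine mem_of_emb _ (fun X x => ?_) a
    refine ⟨regular PUnit.{u + 1}, ⟨fun _ => x, fun _ _ _ => rfl, fun g _ => ?_, fun g _ => ?_⟩,
      ⟨PUnit.unit⟩, AddSubgroup.mem_zmultiples _⟩
    · exact (X.left.one_smul x).symm
    · rw [Subsingleton.elim g 1, one_smul]
  obtain ⟨n, rfl⟩ := AddSubgroup.mem_zmultiples_iff.1 h
  rw [map_zsmul, card_one, smul_eq_mul, mul_one]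

end BisetGroup

namespace DoubleBurnsideRing

open MulOpposite FinBiset BisetGroup Matrix

variable (G : Type u) [Group G] [Finite G]

/-! ### The ideal of products as a matrix ring -/

/-- The classes `[G] - [1]` and `[1]` of `G`-sets: they are orthogonal for the pairing
`⟨v, w⟩ = v° ∘ w`. -/
noncomputable def orthVec : Fin 2 → BisetGroup G PUnit.{u + 1} :=
  ![cls (ofSet G) - cls (ofSet PUnit.{u + 1}), cls (ofSet PUnit.{u + 1})]

/-- The Gram matrix of the vectors `orthVec G`. -/
noncomputable def gram : Matrix (Fin 2) (Fin 2) ℤ := diagonal ![(Nat.card G : ℤ) - 1, 1]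

theorem card_self_comp (B : Type u) [Finite B] [MulAction G B] :
    card (comp (dual (cls (ofSet (G := G) G))) (cls (ofSet B))) = Nat.card B := by
  rw [dual_cls, comp_cls, card_cls, Nat.card_congr (selfTensorEquiv B)]

omit [Finite G] in
theorem card_punit_comp (B : Type u) [Finite B] [Nonempty B] [MulAction G B]
    [MulAction.IsPretransitive G B] :
    card (comp (dual (cls (ofSet (G := G) PUnit.{u + 1}))) (cls (ofSet B))) = 1 := by
  rw [dual_cls, comp_cls, card_cls, card_punit_tensor, Nat.cast_one]

/-- The pairing of two `G`-sets counts the orbits on their product: `p` for the pair `G, G` and `1`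
for the other pairs. Hence `[G] - [1]` has square `p - 1 - 1 + 1` and is orthogonal to `[1]`. -/
theorem dual_orthVec_comp (i j : Fin 2) :
    comp (dual (orthVec G i)) (orthVec G j) = gram G i j • cls (regular PUnit.{u + 1}) := by
  rw [eq_card_zsmul (comp (dual (orthVec G i)) (orthVec G j))]
  congr 1
  have h1 := card_self_comp G G
  have h2 := card_self_comp G PUnit.{u + 1}
  have h3 := card_punit_comp G G
  have h4 := card_punit_comp G PUnit.{u + 1}
  rw [Nat.card_unique, Nat.cast_one] at h2
  fin_cases i <;> fin_cases j <;> simp [orthVec, gram, h1, h2, h3, h4]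

/-- The matrix units attached to the vectors `orthVec G`. -/
noncomputable def unit (i j : Fin 2) : DoubleBurnsideRing G :=
  comp (orthVec G i) (dual (orthVec G j))

theorem mul_def (a b : DoubleBurnsideRing G) : a * b = comp a b := rfl

theorem star_def (a : DoubleBurnsideRing G) : star a = dual a := rfl

/-- The two inner factors compose to an integer multiple of the identity of `B(1, 1)`, which comes
out as a scalar. -/
theorem unit_mul_unit (i j k l : Fin 2) :
    unit G i j * unit G k l = gram G j k • unit G i l := by
  rw [mul_def, unit, unit, comp_assoc, ← comp_assoc (dual _), dual_orthVec_comp, map_zsmul,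
    AddMonoidHom.zsmul_apply, id_comp, map_zsmul]
  rfl

theorem star_unit (i j : Fin 2) : star (unit G i j) = unit G j i := by
  rw [star_def, unit, dual_comp, dual_dual]
  rfl

variable {G}

/-- The class of a twisted biset. -/
noncomputable def tw (φ : MulAut G) : DoubleBurnsideRing G := cls (twist φ)

theorem tw_one : tw (1 : MulAut G) = 1 := cls_eq twistOne

theorem tw_mul (φ ψ : MulAut G) : tw φ * tw ψ = tw (φ * ψ) :=
  (comp_cls _ _).trans (cls_eq (twistTensor φ ψ))

theorem star_tw (φ : MulAut G) : star (tw φ) = tw φ⁻¹ :=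
  (dual_cls _).trans (cls_eq (twistOpposite φ))

theorem tw_comp_orthVec (φ : MulAut G) (i : Fin 2) : comp (tw φ) (orthVec G i) = orthVec G i := by
  have h1 : comp (tw φ) (cls (ofSet (G := G) G)) = cls (ofSet (G := G) G) :=
    (comp_cls _ _).trans (cls_eq (twistOfSetSelf φ))
  have h2 : comp (tw φ) (cls (ofSet (G := G) PUnit.{u + 1})) = cls (ofSet (G := G) PUnit.{u + 1}) :=
    (comp_cls _ _).trans (cls_eq (twistOfSetPUnit φ))
  fin_cases i
  · exact (map_sub _ _ _).trans (congrArg₂ _ h1 h2)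
  · exact h2

theorem tw_mul_unit (φ : MulAut G) (i j : Fin 2) : tw φ * unit G i j = unit G i j := by
  rw [mul_def, unit, ← comp_assoc, tw_comp_orthVec]

/-- Dual to `tw_mul_unit`. -/
theorem unit_mul_tw (φ : MulAut G) (i j : Fin 2) : unit G i j * tw φ = unit G i j := by
  rw [← star_star (unit G i j * tw φ), star_mul, star_unit, star_tw, tw_mul_unit, star_unit]

variable (G)

/-- The combination of matrix units given by a matrix. -/
noncomputable def ofMatrix : Matrix (Fin 2) (Fin 2) ℤ →+ DoubleBurnsideRing G where
  toFun M := ∑ i, ∑ j, M i j • unit G i j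
  map_zero' := by simp
  map_add' M N := by simp [add_smul, Finset.sum_add_distrib]

theorem ofMatrix_apply (M : Matrix (Fin 2) (Fin 2) ℤ) :
    ofMatrix G M = ∑ i, ∑ j, M i j • unit G i j := rfl

theorem ofMatrix_mul (M N : Matrix (Fin 2) (Fin 2) ℤ) :
    ofMatrix G M * ofMatrix G N = ofMatrix G (M * gram G * N) := by
  simp only [ofMatrix_apply, Fin.sum_univ_two, add_mul, mul_add, smul_mul_smul_comm, unit_mul_unit,
    Matrix.mul_apply]
  module

theorem star_ofMatrix (M : Matrix (Fin 2) (Fin 2) ℤ) :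
    star (ofMatrix G M) = ofMatrix G Mᵀ := by
  simp only [ofMatrix_apply, Fin.sum_univ_two, star_add, star_zsmul, star_unit, transpose_apply]
  abel

theorem tw_mul_ofMatrix (φ : MulAut G) (M : Matrix (Fin 2) (Fin 2) ℤ) :
    tw φ * ofMatrix G M = ofMatrix G M := by
  simp only [ofMatrix_apply, Finset.mul_sum, mul_smul_comm, tw_mul_unit]

theorem ofMatrix_mul_tw (φ : MulAut G) (M : Matrix (Fin 2) (Fin 2) ℤ) :
    ofMatrix G M * tw φ = ofMatrix G M := by
  simp only [ofMatrix_apply, Finset.sum_mul, smul_mul_assoc, unit_mul_tw]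

theorem twistedCount_ofMatrix (φ : MulAut G) (M : Matrix (Fin 2) (Fin 2) ℤ) :
    twistedCount φ (ofMatrix G M) = 0 := by
  have h : ∀ i j, twistedCount φ (unit G i j) = 0 := fun i j => twistedCount_comp φ _ _
  rw [ofMatrix_apply, map_sum]
  simp only [map_sum, map_zsmul, h, smul_zero, Finset.sum_const_zero]

/-- Composing with `orthVec G k` and `orthVec G l` on the two sides recovers `M k l` times two
diagonal entries of the Gram matrix, which are nonzero because `1 < Nat.card G`. -/
theorem ofMatrix_injective (hG : 1 < Nat.card G) : Function.Injective (ofMatrix G) := by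
  rw [injective_iff_map_eq_zero]
  intro M hM
  have hd : ∀ i, gram G i i ≠ 0 := by
    intro i
    fin_cases i <;> simp [gram]
    omega
  have hoff : ∀ i j, i ≠ j → gram G i j = 0 := fun i j h => diagonal_apply_ne _ h
  have key : ∀ k i j l, card (comp (dual (orthVec G k)) (comp (unit G i j) (orthVec G l))) =
      gram G k i * gram G j l := by
    intro k i j l
    rw [unit, comp_assoc, dual_orthVec_comp, map_zsmul, comp_id, map_zsmul, dual_orthVec_comp,
      map_zsmul, map_zsmul, card_one, smul_eq_mul, smul_eq_mul, mul_one, mul_comm]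
  ext k l
  have h : card (comp (dual (orthVec G k)) (comp (ofMatrix G M) (orthVec G l))) =
      gram G k k * M k l * gram G l l := by
    rw [ofMatrix_apply]
    simp only [Fin.sum_univ_two, map_add, map_zsmul, AddMonoidHom.add_apply,
      AddMonoidHom.zsmul_apply, key]
    fin_cases k <;> fin_cases l <;> simp [hoff, mul_comm, mul_left_comm]
  rw [hM] at h
  simpa [hd] using h

variable {G}

theorem cls_box_eq_ofMatrix (A B : Type u) [Finite A] [Finite B] [MulAction G A] [MulAction G B]
    (v w : Fin 2 → ℤ) (hA : cls (ofSet (G := G) A) = ∑ i, v i • orthVec G i)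
    (hB : cls (ofSet (G := G) B) = ∑ i, w i • orthVec G i) :
    cls (box A B) = ofMatrix G (vecMulVec v w) := by
  rw [box, ← comp_cls, ← dual_cls, hA, hB, ofMatrix_apply]
  simp only [map_sum, map_zsmul, AddMonoidHom.finsetSum_apply, AddMonoidHom.zsmul_apply,
    Finset.smul_sum, smul_smul, vecMulVec_apply]
  rw [Finset.sum_comm]
  simp only [mul_comm (w _)]
  rfl

/-- The combinations on the right form a subgroup, so by `mem_of_emb` it is enough that it contains
the five kinds of bisets of `exists_emb`. -/
theorem exists_eq_sum [Fintype (MulAut G)] (hG : (Nat.card G).Prime) (a : DoubleBurnsideRing G) :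
    ∃ (n : MulAut G → ℤ) (M : Matrix (Fin 2) (Fin 2) ℤ),
      a = ∑ φ, n φ • tw φ + ofMatrix G M := by
  classical
  let S : AddSubgroup (DoubleBurnsideRing G) :=
    { carrier := {a | ∃ (n : MulAut G → ℤ) (M : Matrix (Fin 2) (Fin 2) ℤ),
        a = ∑ φ, n φ • tw φ + ofMatrix G M}
      zero_mem' := ⟨0, 0, by simp⟩
      add_mem' := by
        rintro _ _ ⟨n, M, rfl⟩ ⟨n', M', rfl⟩
        refine ⟨n + n', M + M', ?_⟩
        simp only [Pi.add_apply, add_smul, Finset.sum_add_distrib, map_add]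
        abel
      neg_mem' := by
        rintro _ ⟨n, M, rfl⟩
        refine ⟨-n, -M, ?_⟩
        simp only [Pi.neg_apply, neg_smul, Finset.sum_neg_distrib, map_neg]
        abel }
  have h0 : cls (ofSet (G := G) G) = ∑ i, (![1, 1] : Fin 2 → ℤ) i • orthVec G i := by
    simp [orthVec]
  have h1 : cls (ofSet (G := G) PUnit.{u + 1}) =
      ∑ i, (![0, 1] : Fin 2 → ℤ) i • orthVec G i := by
    simp [orthVec]
  have hS : ∀ M, ofMatrix G M ∈ S := fun M => ⟨0, M, by simp⟩
  refine mem_of_emb S (fun X x => ?_) a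
  rcases exists_emb hG X x with ⟨φ, ⟨f⟩⟩ | ⟨⟨f⟩⟩ | ⟨⟨f⟩⟩ | ⟨⟨f⟩⟩ | ⟨⟨f⟩⟩
  · exact ⟨_, f, ⟨(1 : G)⟩, Pi.single φ 1, 0, by simp [Pi.single_apply, ite_smul]; rfl⟩
  · exact ⟨_, f, ⟨bmk 1 1⟩, cls_box_eq_ofMatrix G G _ _ h0 h0 ▸ hS _⟩
  · exact ⟨_, f, ⟨bmk 1 PUnit.unit⟩, cls_box_eq_ofMatrix G PUnit _ _ h0 h1 ▸ hS _⟩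
  · exact ⟨_, f, ⟨bmk PUnit.unit 1⟩, cls_box_eq_ofMatrix PUnit G _ _ h1 h0 ▸ hS _⟩
  · exact ⟨_, f, ⟨bmk PUnit.unit PUnit.unit⟩, cls_box_eq_ofMatrix PUnit PUnit _ _ h1 h1 ▸ hS _⟩

end DoubleBurnsideRing

namespace DoubleBurnsideRing

open BisetGroup Matrix

variable {G : Type u} [Group G] [Finite G]

/-! ### Reduction of orthogonal units to integer matrices -/

/-- The homomorphism from `{±1} × Aut G × T` to the double Burnside ring given by a family of
matrices indexed by a group `T`. -/
noncomputable def signTwistHom {T : Type*} [Group T] (N : T → Matrix (Fin 2) (Fin 2) ℤ)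
    (hone : N 1 = 0) (hmul : ∀ s t, N (s * t) = N s + N t + N s * gram G * N t) :
    ℤˣ × MulAut G × T →* DoubleBurnsideRing G where
  toFun x := (x.1 : ℤ) • (tw x.2.1 + ofMatrix G (N x.2.2))
  map_one' := by simp [hone, tw_one]
  map_mul' x y := by
    simp only [Prod.fst_mul, Prod.snd_mul, Units.val_mul, hmul, map_add, smul_mul_smul_comm,
      add_mul, mul_add, tw_mul, tw_mul_ofMatrix, ofMatrix_mul_tw, ofMatrix_mul]
    congr 1
    abel

theorem signTwistHom_apply {T : Type*} [Group T] (N : T → Matrix (Fin 2) (Fin 2) ℤ) (hone) (hmul)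
    (x : ℤˣ × MulAut G × T) :
    signTwistHom N hone hmul x = (x.1 : ℤ) • (tw x.2.1 + ofMatrix G (N x.2.2)) := rfl

theorem star_signTwistHom {T : Type*} [Group T] (N : T → Matrix (Fin 2) (Fin 2) ℤ) (hone) (hmul)
    (hinv : ∀ t, N t⁻¹ = (N t)ᵀ) (x : ℤˣ × MulAut G × T) :
    star (signTwistHom N hone hmul x) = signTwistHom N hone hmul x⁻¹ := by
  simp only [signTwistHom_apply, Prod.fst_inv, Prod.snd_inv, hinv, star_zsmul, star_add,
    star_tw, star_ofMatrix, Int.units_inv_eq_self]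

theorem twistedCount_tw [DecidableEq (MulAut G)] (hG : (Nat.card G).Prime) (φ ψ : MulAut G) :
    twistedCount φ (tw ψ) = if φ = ψ then (Nat.card G : ℤ) else 0 :=
  twistedCount_twist hG φ ψ

/-- A family of integers whose squares add up to one is a sign at one place. -/
theorem exists_single_of_sum_sq {ι : Type*} [Fintype ι] [DecidableEq ι] (n : ι → ℤ)
    (h : ∑ i, n i * n i = 1) : ∃ (i : ι) (e : ℤˣ), n = Pi.single i (e : ℤ) := by
  obtain ⟨i, hi⟩ : ∃ i, n i ≠ 0 := by
    by_contra! h'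
    simp [h'] at h
  have hsplit := Finset.add_sum_erase Finset.univ (fun j => n j * n j) (Finset.mem_univ i)
  rw [h] at hsplit
  have hnn : ∀ j ∈ Finset.univ.erase i, 0 ≤ n j * n j := fun j _ => mul_self_nonneg _
  have hpos : 0 < n i * n i := mul_self_pos.2 hi
  -- A positive integer square is at least `1`, so nothing is left for the other terms.
  have h0 : ∑ j ∈ Finset.univ.erase i, n j * n j = 0 := by
    have := Finset.sum_nonneg hnn
    omega
  have hii : n i * n i = 1 := by
    omega
  refine ⟨i, ⟨n i, n i, hii, hii⟩, ?_⟩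
  ext j
  by_cases hj : j = i
  · subst hj
    simp
  · have := (Finset.sum_eq_zero_iff_of_nonneg hnn).1 h0 j (by simp [hj])
    rw [Pi.single_eq_of_ne hj]
    exact mul_self_eq_zero.1 this

/-- Applying `twistedCount 1` to `u u° = 1` kills all terms from the ideal and leaves `Nat.card G`
times the sum of the squares of the coefficients, so exactly one coefficient is nonzero and it is
`±1`. -/
theorem exists_sign_twist (hG : (Nat.card G).Prime) (u : DoubleBurnsideRing G)
    (hu : u * star u = 1) :
    ∃ (e : ℤˣ) (φ : MulAut G) (M : Matrix (Fin 2) (Fin 2) ℤ),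
      u = (e : ℤ) • (tw φ + ofMatrix G M) := by
  classical
  have : Fintype (MulAut G) := Fintype.ofFinite _
  obtain ⟨n, M, rfl⟩ := exists_eq_sum hG u
  have h := congrArg (twistedCount (1 : MulAut G)) hu
  have hsum : ∑ φ, n φ * n φ = 1 := by
    have h1 : twistedCount (1 : MulAut G) (1 : DoubleBurnsideRing G) = Nat.card G := by
      rw [← tw_one, twistedCount_tw hG, if_pos rfl]
    simp only [star_add, star_sum, star_zsmul, star_tw, star_ofMatrix, add_mul, mul_add,
      Finset.sum_mul, Finset.mul_sum, smul_mul_assoc,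
      mul_smul_comm, tw_mul, tw_mul_ofMatrix, ofMatrix_mul_tw, ofMatrix_mul, map_add, map_sum,
      map_zsmul, twistedCount_ofMatrix, twistedCount_tw hG, h1] at h
    have hne : (Nat.card G : ℤ) ≠ 0 := by exact_mod_cast hG.ne_zero
    refine mul_right_cancel₀ hne ?_
    rw [one_mul]
    refine Eq.trans ?_ h
    rw [Finset.sum_mul]
    simp [eq_comm (a := (1 : MulAut G)), mul_inv_eq_one, mul_assoc]
  obtain ⟨φ, e, rfl⟩ := exists_single_of_sum_sq n hsum
  -- The sign is also put in front of `M`, which is harmless as `e * e = 1`.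
  refine ⟨e, φ, (e : ℤ) • M, ?_⟩
  rw [smul_add, map_zsmul, smul_smul, ← Units.val_mul, Int.units_mul_self, Units.val_one, one_smul]
  congr 1
  simp [Pi.single_apply, ite_smul]

/-- The group of orthogonal units is `{±1} × Aut G × T` as soon as the group `T` parametrizes the
integer matrices `M` such that `1 + M` is orthogonal. -/
theorem nonempty_orthogonalUnits_mulEquiv (hG : (Nat.card G).Prime) {T : Type*} [Group T]
    (N : T → Matrix (Fin 2) (Fin 2) ℤ) (hinj : Function.Injective N) (hone : N 1 = 0)
    (hmul : ∀ s t, N (s * t) = N s + N t + N s * gram G * N t) (hinv : ∀ t, N t⁻¹ = (N t)ᵀ)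
    (hsurj : ∀ M : Matrix (Fin 2) (Fin 2) ℤ, M + Mᵀ + M * gram G * Mᵀ = 0 →
      M + Mᵀ + Mᵀ * gram G * M = 0 → ∃ t, N t = M) :
    Nonempty (orthogonalUnits G ≃* ℤˣ × MulAut G × T) := by
  classical
  let F := signTwistHom N hone hmul
  have hF : ∀ x, F x * star (F x) = 1 ∧ star (F x) * F x = 1 := fun x => by
    rw [star_signTwistHom N hone hmul hinv, ← map_mul, ← map_mul, mul_inv_cancel,
      inv_mul_cancel, map_one]
    exact ⟨rfl, rfl⟩
  let Ψ : ℤˣ × MulAut G × T →* orthogonalUnits G := F.toHomUnits.codRestrict _ hF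
  have hΨ : ∀ x, ((Ψ x : (DoubleBurnsideRing G)ˣ) : DoubleBurnsideRing G) = F x := fun _ => rfl
  refine ⟨(MulEquiv.ofBijective Ψ ⟨?_, ?_⟩).symm⟩
  · rw [injective_iff_map_eq_one]
    rintro ⟨e, φ, t⟩ h
    have hx : (e : ℤ) • (tw φ + ofMatrix G (N t)) = 1 := by
      change F (e, φ, t) = 1
      rw [← hΨ, h]
      rfl
    -- The count at the identity ignores the matrix: it forces `φ = 1` and then `e = 1`, after which
    -- the matrix must vanish.
    have hc := congrArg (twistedCount (1 : MulAut G)) hx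
    rw [← tw_one, map_zsmul, map_add, twistedCount_ofMatrix, add_zero, twistedCount_tw hG,
      twistedCount_tw hG, if_pos rfl] at hc
    have hne : (Nat.card G : ℤ) ≠ 0 := by exact_mod_cast hG.ne_zero
    have hφ : φ = 1 := by
      by_contra hφ
      rw [if_neg (Ne.symm hφ), smul_zero] at hc
      exact hne hc.symm
    subst hφ
    have he : e = 1 := by
      rw [if_pos rfl, smul_eq_mul] at hc
      exact Units.ext (mul_right_cancel₀ hne (by rw [hc, Units.val_one, one_mul]))
    subst he
    rw [Units.val_one, one_smul, tw_one, add_eq_left] at hx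
    have ht : N t = N 1 :=
      ofMatrix_injective G hG.one_lt (by rw [hx, hone, map_zero])
    rw [hinj ht]
    rfl
  · rintro ⟨u, hu, hu'⟩
    obtain ⟨e, φ, M, h⟩ := exists_sign_twist hG (u : DoubleBurnsideRing G) hu
    have he : (e : ℤ) * e = 1 := by rw [← Units.val_mul, Int.units_mul_self, Units.val_one]
    -- The signs cancel, `φ φ⁻¹ = 1`, and twists disappear next to matrices; what remains of the two
    -- equations concerns `M` alone.
    simp only [h, star_zsmul, star_add, star_tw, star_ofMatrix, smul_mul_smul_comm, he, one_smul,
      add_mul, mul_add, tw_mul, mul_inv_cancel, inv_mul_cancel, tw_one, tw_mul_ofMatrix,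
      ofMatrix_mul_tw, ofMatrix_mul] at hu hu'
    have h1 : M + Mᵀ + M * gram G * Mᵀ = 0 := by
      apply ofMatrix_injective G hG.one_lt
      rw [map_add, map_add, map_zero]
      rw [add_assoc, add_eq_left] at hu
      rw [← hu]
      abel
    have h2 : M + Mᵀ + Mᵀ * gram G * M = 0 := by
      apply ofMatrix_injective G hG.one_lt
      rw [map_add, map_add, map_zero]
      rw [add_assoc, add_eq_left] at hu'
      rw [← hu']
      abel
    obtain ⟨t, rfl⟩ := hsurj M h1 h2
    refine ⟨(e, φ, t), Subtype.ext (Units.ext ?_)⟩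
    rw [hΨ, h]
    rfl

end DoubleBurnsideRing

/-- The automorphism group of a cyclic group of order `p` is the unit group of `ZMod p`, cyclic of
order `p - 1`. -/
theorem nonempty_mulAut_mulEquiv {G : Type*} [Group G] [Finite G] {p : ℕ} (hp : p.Prime)
    (hG : Nat.card G = p) : Nonempty (MulAut G ≃* Multiplicative (ZMod (p - 1))) := by
  have : Fact p.Prime := ⟨hp⟩
  have : IsCyclic G := isCyclic_of_prime_card hG
  have e := IsCyclic.mulAutMulEquiv G
  rw [hG] at e
  have hc : Nat.card (ZMod p)ˣ = p - 1 := by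
    rw [Nat.card_eq_fintype_card, ZMod.card_units]
  have e' := zmodCyclicMulEquiv (G := (ZMod p)ˣ) inferInstance
  rw [hc] at e'
  exact ⟨e.trans e'.symm⟩

theorem nonempty_units_int_mulEquiv : Nonempty (ℤˣ ≃* Multiplicative (ZMod 2)) :=
  ⟨mulEquivOfPrimeCardEq (p := 2) (by simp) (by simp)⟩

namespace DoubleBurnsideRing

open Matrix

/-! ### Integer orthogonal matrices for `diag (d, 1)` -/

/-- The entries of an integer matrix `M` such that `1 + M` is orthogonal for the form
`diag (d, 1)`. -/
theorem orthogonal_entries {d : ℤ} {M : Matrix (Fin 2) (Fin 2) ℤ}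
    (h : M + Mᵀ + M * diagonal ![d, 1] * Mᵀ = 0) (h' : M + Mᵀ + Mᵀ * diagonal ![d, 1] * M = 0) :
    2 * M 0 0 + d * M 0 0 ^ 2 + M 0 1 ^ 2 = 0 ∧ 2 * M 1 1 + d * M 1 0 ^ 2 + M 1 1 ^ 2 = 0 ∧
      M 0 1 + M 1 0 + d * M 0 0 * M 1 0 + M 0 1 * M 1 1 = 0 ∧ M 0 1 ^ 2 = M 1 0 ^ 2 := by
  have h00 := congrFun (congrFun h 0) 0
  have h01 := congrFun (congrFun h 0) 1
  have h11 := congrFun (congrFun h 1) 1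
  have h00' := congrFun (congrFun h' 0) 0
  simp [Matrix.mul_apply, Fin.sum_univ_two] at h00 h01 h11 h00'
  refine ⟨?_, ?_, ?_, ?_⟩ <;> linarith

/-- The second row gives `d * c ^ 2 + (e + 1) ^ 2 = 1` with `c = M 1 0` and `e = M 1 1`, so `c = 0`
when `d ≥ 2`, and `M 0 1 ^ 2 = c ^ 2` makes `M` diagonal. The diagonal entries then solve `a * (2 +
d * a) = 0` and `e * (2 + e) = 0`. -/
theorem orthogonal_entries_of_two_le {d : ℤ} (hd : 2 ≤ d) {M : Matrix (Fin 2) (Fin 2) ℤ}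
    (h : M + Mᵀ + M * diagonal ![d, 1] * Mᵀ = 0) (h' : M + Mᵀ + Mᵀ * diagonal ![d, 1] * M = 0) :
    (M 0 0 = 0 ∨ d = 2 ∧ M 0 0 = -1) ∧ M 0 1 = 0 ∧ M 1 0 = 0 ∧ (M 1 1 = 0 ∨ M 1 1 = -2) := by
  obtain ⟨h1, h2, -, h4⟩ := orthogonal_entries h h'
  have hc : M 1 0 = 0 := by
    by_contra hne
    have : 0 < M 1 0 ^ 2 := by positivity
    nlinarith [sq_nonneg (M 1 1 + 1)]
  have hb : M 0 1 = 0 := by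
    rw [hc] at h4
    simpa using h4
  rw [hb] at h1
  rw [hc] at h2
  refine ⟨?_, hb, hc, ?_⟩
  · rcases mul_eq_zero.1 (show M 0 0 * (2 + d * M 0 0) = 0 by linarith) with h | h
    · exact Or.inl h
    · right
      -- From `d * a = -2` with `d ≥ 2`, the only integral possibility is `a = -1`, `d = 2`.
      have hneg : M 0 0 < 0 := by nlinarith
      have : -1 ≤ M 0 0 := by nlinarith
      have h0 : M 0 0 = -1 := by omega
      rw [h0] at h
      exact ⟨by linarith, h0⟩
  · rcases mul_eq_zero.1 (show M 1 1 * (2 + M 1 1) = 0 by linarith) with h | h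
    · exact Or.inl h
    · exact Or.inr (by linarith)

/-- The dihedral group of order `8` as the group of integer orthogonal matrices of size `2`,
translated by the identity. -/
def dihedralMatrix : DihedralGroup 4 → Matrix (Fin 2) (Fin 2) ℤ
  -- Adding the identity gives the powers of the quarter turn, and in the next line their products
  -- on the left with `diag (1, -1)`.
  | .r i => ![!![0, 0; 0, 0], !![-1, -1; 1, -1], !![-2, 0; 0, -2], !![-1, 1; -1, -1]] i
  | .sr i => ![!![0, 0; 0, -2], !![-1, -1; -1, -1], !![-2, 0; 0, 0], !![-1, 1; 1, -1]] i

theorem exists_dihedralMatrix {M : Matrix (Fin 2) (Fin 2) ℤ}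
    (h : M + Mᵀ + M * diagonal ![1, 1] * Mᵀ = 0) (h' : M + Mᵀ + Mᵀ * diagonal ![1, 1] * M = 0) :
    ∃ t, dihedralMatrix t = M := by
  obtain ⟨h1, h2, h3, h4⟩ := orthogonal_entries h h'
  rw [eta_fin_two M]
  generalize M 0 0 = a, M 0 1 = b, M 1 0 = c, M 1 1 = e at *
  -- The rows lie on circles, `(a + 1) ^ 2 + b ^ 2 = 1` and `c ^ 2 + (e + 1) ^ 2 = 1`, which leaves
  -- finitely many matrices to check.
  have ha : -2 ≤ a := by nlinarith
  have ha' : a ≤ 0 := by nlinarith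
  have he : -2 ≤ e := by nlinarith
  have he' : e ≤ 0 := by nlinarith
  have hb : -1 ≤ b := by nlinarith [sq_nonneg (a + 1)]
  have hb' : b ≤ 1 := by nlinarith [sq_nonneg (a + 1)]
  have hc : -1 ≤ c := by nlinarith [sq_nonneg (e + 1)]
  have hc' : c ≤ 1 := by nlinarith [sq_nonneg (e + 1)]
  have key : ∀ a ∈ Finset.Icc (-2 : ℤ) 0, ∀ b ∈ Finset.Icc (-1 : ℤ) 1,
      ∀ c ∈ Finset.Icc (-1 : ℤ) 1, ∀ e ∈ Finset.Icc (-2 : ℤ) 0,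
      2 * a + 1 * a ^ 2 + b ^ 2 = 0 → 2 * e + 1 * c ^ 2 + e ^ 2 = 0 →
      b + c + 1 * a * c + b * e = 0 → ∃ t, dihedralMatrix t = !![a, b; c, e] := by
    decide
  exact key a (Finset.mem_Icc.2 ⟨ha, ha'⟩) b (Finset.mem_Icc.2 ⟨hb, hb'⟩)
    c (Finset.mem_Icc.2 ⟨hc, hc'⟩) e (Finset.mem_Icc.2 ⟨he, he'⟩) h1 h2 h3

theorem gram_eq {G : Type u} {p : ℕ} (hG : Nat.card G = p) {d : ℤ} (hd : (p : ℤ) - 1 = d) :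
    gram G = diagonal ![d, 1] := by
  rw [gram, hG, hd]

variable {G : Type u} [Group G] [Finite G]

theorem nonempty_orthogonalUnits_mulEquiv_two (hG : Nat.card G = 2) :
    Nonempty (orthogonalUnits G ≃* ℤˣ × MulAut G × DihedralGroup 4) := by
  have hg : gram G = diagonal ![1, 1] := gram_eq hG rfl
  refine nonempty_orthogonalUnits_mulEquiv (hG ▸ Nat.prime_two) dihedralMatrix ?_ ?_ ?_ ?_ ?_ <;>
    try rw [hg]
  · decide
  · decide
  · decide
  · decide
  · exact fun M h h' => exists_dihedralMatrix h h'

theorem nonempty_orthogonalUnits_mulEquiv_three (hG : Nat.card G = 3) :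
    Nonempty (orthogonalUnits G ≃* ℤˣ × MulAut G × ℤˣ × ℤˣ) := by
  have hg : gram G = diagonal ![2, 1] := gram_eq hG rfl
  refine nonempty_orthogonalUnits_mulEquiv (hG ▸ Nat.prime_three)
    -- The first entry runs over `0` and `-1`, the second over `0` and `-2`; the division by `2` is
    -- exact on both signs.
    (fun t => diagonal ![((t.1 : ℤ) - 1) / 2, (t.2 : ℤ) - 1]) ?_ ?_ ?_ ?_ ?_ <;>
    try rw [hg]
  · decide
  · decide
  · decide
  · decide
  · intro M h h'
    obtain ⟨ha, hb, hc, he⟩ := orthogonal_entries_of_two_le le_rfl h h'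
    rw [eta_fin_two M, hb, hc]
    rcases ha with ha | ⟨-, ha⟩ <;> rcases he with he | he <;> rw [ha, he] <;> decide

theorem nonempty_orthogonalUnits_mulEquiv_of_three_lt {p : ℕ} (hp : p.Prime)
    (hG : Nat.card G = p) (h3 : 3 < p) :
    Nonempty (orthogonalUnits G ≃* ℤˣ × MulAut G × ℤˣ) := by
  have hg : gram G = diagonal ![(p : ℤ) - 1, 1] := gram_eq hG rfl
  refine nonempty_orthogonalUnits_mulEquiv (hG ▸ hp)
    (fun t => diagonal ![0, (t : ℤ) - 1]) ?_ ?_ ?_ ?_ ?_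
  · decide
  · decide
  · intro s t
    rw [hg, diagonal_mul_diagonal, diagonal_mul_diagonal, diagonal_add, diagonal_add]
    congr 1
    ext i
    fin_cases i
    · simp
    · simp
      ring
  · decide
  · rw [hg]
    intro M h h'
    obtain ⟨ha, hb, hc, he⟩ := orthogonal_entries_of_two_le (by omega) h h'
    -- The alternative `M 0 0 = -1` would need `p - 1 = 2`.
    have ha : M 0 0 = 0 := by omega
    rw [eta_fin_two M, ha, hb, hc]
    rcases he with he | he <;> rw [he] <;> decide

end DoubleBurnsideRing

/-! ### Identification with the stated groups -/

theorem proposition5 (p : ℕ) (hp : p.Prime) (G : Type u) [Group G] [Finite G]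
    (hG : Nat.card G = p) :
    (p = 2 → Nonempty (DoubleBurnsideRing.orthogonalUnits G ≃*
      Multiplicative (ZMod 2) × DihedralGroup 4)) ∧
    (p = 3 → Nonempty (DoubleBurnsideRing.orthogonalUnits G ≃*
      Multiplicative (ZMod (p - 1)) × (Fin 3 → Multiplicative (ZMod 2)))) ∧
    (3 < p → Nonempty (DoubleBurnsideRing.orthogonalUnits G ≃*
      Multiplicative (ZMod (p - 1)) × (Fin 2 → Multiplicative (ZMod 2)))) := by
  obtain ⟨a⟩ := nonempty_mulAut_mulEquiv hp hG
  obtain ⟨s⟩ := nonempty_units_int_mulEquiv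
  refine ⟨?_, ?_, fun h3 => ?_⟩
  · rintro rfl
    obtain ⟨e⟩ := DoubleBurnsideRing.nonempty_orthogonalUnits_mulEquiv_two hG
    -- For `p = 2` the automorphism group is trivial and drops out.
    have : Unique (MulAut G) := (show MulAut G ≃ ZMod 1 from a.toEquiv).unique
    exact ⟨e.trans (s.prodCongr MulEquiv.uniqueProd)⟩
  · rintro rfl
    obtain ⟨e⟩ := DoubleBurnsideRing.nonempty_orthogonalUnits_mulEquiv_three hG
    -- The three factors of order 2 are the global sign and the two diagonal signs.
    let f : ℤˣ × MulAut G × ℤˣ × ℤˣ ≃*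
        Multiplicative (ZMod (3 - 1)) × (Fin 3 → Multiplicative (ZMod 2)) :=
      { toFun := fun x => (a x.2.1, ![s x.1, s x.2.2.1, s x.2.2.2])
        invFun := fun y => (s.symm (y.2 0), a.symm y.1, s.symm (y.2 1), s.symm (y.2 2))
        left_inv := fun x => by simp
        right_inv := fun y => by
          refine Prod.ext (by simp) ?_
          ext i
          fin_cases i <;> simp
        map_mul' := fun x y => by
          refine Prod.ext (by simp) ?_
          ext i
          fin_cases i <;> simp }
    exact ⟨e.trans f⟩
  · obtain ⟨e⟩ := DoubleBurnsideRing.nonempty_orthogonalUnits_mulEquiv_of_three_lt hp hG h3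
    let f : ℤˣ × MulAut G × ℤˣ ≃*
        Multiplicative (ZMod (p - 1)) × (Fin 2 → Multiplicative (ZMod 2)) :=
      { toFun := fun x => (a x.2.1, ![s x.1, s x.2.2])
        invFun := fun y => (s.symm (y.2 0), a.symm y.1, s.symm (y.2 1))
        left_inv := fun x => by simp
        right_inv := fun y => by
          refine Prod.ext (by simp) ?_
          ext i
          fin_cases i <;> simp
        map_mul' := fun x y => by
          refine Prod.ext (by simp) ?_
          ext i
          fin_cases i <;> simp }
    exact ⟨e.trans f⟩
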